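/- **Setting.** An instance of element-weighted $k$-cover consists of $n\ge 1$ sets $S_1,\dots,S_n$ over a ground set $\mathcal E$ of $m$ elements, each element $v$ with an integer weight $0\le w_v\le U$, and a number $0\le k\le n$; every element lies in at least one set. For a subfamily $\mathcal S$ let $\mathcal C(\mathcal S)$ be the total weight of the elements in the union of $\mathcal S$. An $\alpha$-approximate solution is a choice $\mathcal S$ of $k$ sets such that $\mathcal C(\mathcal S)\ge\alpha\,\mathcal C(\mathcal S')$ for every choice $\mathcal S'$ of $k$ sets. The input is a list, in arbitrary order, of the records $(v,i)$ for $v\in S_i$ and $(v,w_v)$ for $v\in\mathcal E$. There are $m+1$ machines. The numbers $n,m,k,U$ and the total weight $W=\sum_v w_v$ are known to all of them. At the start of the first round every record is delivered to a machine that is determined by this record (and the known numbers) alone. In each round every machine, knowing the round number and its own address, flips private fair coins (all coins are independent; random bits are not charged as space), computes from its memory, its coins and the messages it received a new memory and the messages it sends, and these messages are delivered before the next round. After the last round a designated machine holds the indices of the chosen sets. The algorithm is one computable procedure, used for all values of the parameters other than $\varepsilon$. The space of a machine in a round is its load: the total number of bits of the memory it starts with, the messages or records it receives, the memory it ends with,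 and the messages it sends. **Theorem.** There is an absolute constant $c$ such that for every $\varepsilon\in(0,1]$ there are a constant $C=C(\varepsilon)$ and a four-round distributed algorithm with the following property. On every instance as above, with probability at least $1-\frac2n$, the algorithm outputs a $(1-\frac1e-\varepsilon)$-approximate solution to element-weighted $k$-cover and, in every round, every machine uses at most $C\,n\,(1+\log(n+m+U))^{c}$ bits of space, that is, $\tilde O(n)$. -/

import Mathlib

/-! ### Distributed (MapReduce) computation -/

namespace MapReduce

/-- Contents of a memory, of a message, or of an input record: a finite list of natural numbers. -/
abbrev Data : Type := List ℕ

/-- Number of bits of a piece of data: every entry is charged its binary length plus one bit for a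
separator, and the whole list one more bit (so that even an empty message has a cost). -/
def bits (d : Data) : ℕ := 1 + (d.map fun a => Nat.size a + 1).sum

/-- A message waiting to be sent: the address of the receiving machine and the contents. -/
abbrev Letter : Type := ℕ × Data

/-- What a machine can see in one round: the public parameters, the number of the round, its own
address, the outcomes of its coin flips, its memory, and the messages it has received. -/
abbrev View : Type := List ℕ × ℕ × ℕ × List Bool × Data × List Data

/-- A (uniform, randomized) distributed algorithm. One and the same computable procedure is run by
all machines, in all rounds and for all values of the public parameters.
* `coins` says how many fair coins each machine flips in each round, given the public parameters;
* `route` says to which machine an input record is delivered at the start of the first round; it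
  sees that record (and the public parameters) only;
* `step` is the local computation of one round: it returns the new memory of the machine and
  the messages that it sends. -/
structure Algorithm where
  coins : List ℕ → ℕ
  route : List ℕ × Data → ℕ
  step : View → Data × List Letter
  coins_computable : Computable coins
  route_computable : Computable route
  step_computable : Computable step

/-- The situation at the start of a round: memory and received messages of each of `p` machines. -/
abbrev Config (p : ℕ) : Type := Fin p → Data × List Data

/-- The coin flips of all `p` machines in one round. -/
abbrev RoundCoins (p l : ℕ) : Type := Fin p → Fin l → Bool

/-- All memories are empty, and every input record has been delivered as `route` demands. -/
def initial (A : Algorithm) (pub : List ℕ) (p : ℕ) (input : List Data) : Config p :=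
  fun i => ([], input.filter fun d => A.route (pub, d) = (i : ℕ))

/-- The result of the local computation of machine `i` in round `r`. -/
def localResult (A : Algorithm) (pub : List ℕ) {p l : ℕ} (r : ℕ) (c : RoundCoins p l)
    (s : Config p) (i : Fin p) : Data × List Letter :=
  A.step (pub, r, (i : ℕ), List.ofFn (c i), (s i).1, (s i).2)

/-- One synchronous round: all machines compute, and then all messages are delivered. -/
def nextConfig (A : Algorithm) (pub : List ℕ) {p l : ℕ} (r : ℕ) (c : RoundCoins p l)
    (s : Config p) : Config p :=
  fun j => ((localResult A pub r c s j).1,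
    (List.finRange p).flatMap fun i =>
      ((localResult A pub r c s i).2.filter fun x => x.1 = (j : ℕ)).map Prod.snd)

/-- The situation after the first `r` of `R` rounds (rounds are numbered from `0`). -/
def configAfter (A : Algorithm) (pub : List ℕ) {p l R : ℕ} (input : List Data)
    (ω : Fin R → RoundCoins p l) : ℕ → Config p
  | 0 => initial A pub p input
  | r + 1 =>
    if h : r < R then nextConfig A pub r (ω ⟨r, h⟩) (configAfter A pub input ω r)
    else configAfter A pub input ω r

/-- The space (load), in bits, of machine `i` in round `r`: the memory it starts with, all it
receives, the memory it ends with, and all it sends (addresses included). -/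
def space (A : Algorithm) (pub : List ℕ) {p l R : ℕ} (input : List Data)
    (ω : Fin R → RoundCoins p l) (r : Fin R) (i : Fin p) : ℕ :=
  let s := configAfter A pub input ω r
  let t := localResult A pub r (ω r) s i
  bits (s i).1 + ((s i).2.map bits).sum +
    bits t.1 + (t.2.map fun x => Nat.size x.1 + bits x.2).sum

/-- The output of an `R`-round run: the memory of machine `0` after the last round. -/
def output (A : Algorithm) (pub : List ℕ) {q l R : ℕ} (input : List Data)
    (ω : Fin R → RoundCoins (q + 1) l) : Data :=
  (configAfter A pub input ω R 0).1

end MapReduce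

/-! ### Element-weighted `k`-cover -/

/-- `n` sets over a ground set of `m` elements, each with a natural number as its weight. -/
structure WeightedCover (n m : ℕ) where
  sets : Fin n → Finset (Fin m)
  weight : Fin m → ℕ

namespace WeightedCover

variable {n m : ℕ}

/-- The total weight of the elements covered by the subfamily `T`. -/
def coverage (I : WeightedCover n m) (T : Finset (Fin n)) : ℕ :=
  ∑ v ∈ T.biUnion I.sets, I.weight v

/-- The total weight of all elements. -/
def totalWeight (I : WeightedCover n m) : ℕ := ∑ v, I.weight v

/-- `T` consists of `k` sets and covers at least `α` times the weight covered by any `k` sets. -/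
def IsApproxSolution (I : WeightedCover n m) (k : ℕ) (α : ℝ) (T : Finset (Fin n)) : Prop :=
  T.card = k ∧ ∀ T' : Finset (Fin n), T'.card = k → α * I.coverage T' ≤ I.coverage T

/-- `input` lists, in an arbitrary order and without repetition, a record `[0, v, S]` for every
edge (element `v` lies in set `S`) and a record `[1, v, w]` for every element `v` of weight `w`. -/
def IsInput (I : WeightedCover n m) (input : List MapReduce.Data) : Prop :=
  input.Nodup ∧ ∀ d : MapReduce.Data, d ∈ input ↔
    (∃ (S : Fin n) (v : Fin m), v ∈ I.sets S ∧ d = [0, (v : ℕ), (S : ℕ)]) ∨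
    (∃ v : Fin m, d = [1, (v : ℕ), I.weight v])

/-- The parameters known to all machines: the numbers of sets and of elements, the number of sets
to be picked, the bound on the weights, and the total weight. -/
def publicParams (I : WeightedCover n m) (k U : ℕ) : List ℕ := [n, m, k, U, I.totalWeight]

end WeightedCover

/-!
The algorithm samples elements proportionally to their weights, keeps only few sets per element, and
solves the small sampled instance by exhaustive search on one machine. It reaches the factor
`16 / 25`, which exceeds `1 - 1 / e`, so its constants do not depend on `ε`.

*Capping degrees.* Every element `v` keeps a family `K v` of at most `D ≈ 20 n / k` of the sets that
contain it. Trading a fifth of an optimal family for random sets shows that the optimum drops at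
most to `4 / 5` of its value (`exists_hitWeight_ge_of_capped`). Conversely, `k` random sets show
that the capped optimum `OPT` is at least `k / (22 n)` times `M = ∑ v, w v * #(K v)`
(`exists_hitWeight_ge_sum_degree`).

*Sampling.* Element `v` draws a number `u` uniformly from `{0, …, N - 1}`, where `N` is a power of
two comparable to the total weight, and is sampled at rate `q` if `u < q * w v`. At most `q * M / N`
edges are then expected. At the rate `q₀` at which this is a quarter of the budget
`B = O(n log n)`, the scaled optimum `q₀ * OPT / N` is of order `k log n` by the second bound above.
Chernoff bounds (`UniformIndep.card_score_deviation_le`) and a union bound over the at most `n ^ k`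
families and over all rates in `[q₀, B]` then show that all estimated coverages are correct up to
`OPT / 10`, so that the family with the best estimate is within `4 / 5` of the capped optimum
(`UniformIndep.card_bad_quality_le`).

*Rounds.* The total weight is known, but `M` and hence `q₀` are not. All elements sampled at the
largest rate `B` report their degrees to machine `0`; these are `O(B)` elements
(`UniformIndep.card_many_samples_le`). Machine `0` picks the largest rate at which the sampled edges
fit into the budget, which is at least `q₀` with high probability, and asks the elements sampled at
that rate for their lists. It receives at most `B` edges and searches all families of `k` sets.
-/

open Finset

/-! ### Families of sets hit by a choice -/

section Hit

variable {ι : Type*} [Fintype ι] {n : ℕ}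

/-- The total weight of the elements `v` whose list of sets `K v` meets the family `T`. -/
def hitWeight (w : ι → ℕ) (K : ι → Finset (Fin n)) (T : Finset (Fin n)) : ℕ :=
  ∑ v, if Disjoint (K v) T then 0 else w v

theorem hitWeight_mono_right (w : ι → ℕ) (K : ι → Finset (Fin n)) {T T' : Finset (Fin n)}
    (h : T ⊆ T') : hitWeight w K T ≤ hitWeight w K T' := by
  unfold hitWeight
  gcongr with v
  split_ifs with h1 h2 h2
  · exact le_rfl
  · exact Nat.zero_le _
  · exact absurd (Disjoint.mono_right h h2) h1
  · exact le_rfl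

theorem hitWeight_mono_left (w : ι → ℕ) {K N : ι → Finset (Fin n)} (h : ∀ v, K v ⊆ N v)
    (T : Finset (Fin n)) : hitWeight w K T ≤ hitWeight w N T := by
  unfold hitWeight
  gcongr with v
  split_ifs with h1 h2 h2
  · exact le_rfl
  · exact Nat.zero_le _
  · exact absurd (Disjoint.mono_left (h v) h2) h1
  · exact le_rfl

theorem card_filter_avoid (A : Finset (Fin n)) (r : ℕ) :
    #{f : Fin r → Fin n | Disjoint A (univ.image f)} = (n - #A) ^ r := by
  have : ({f : Fin r → Fin n | Disjoint A (univ.image f)} : Finset _) =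
      Fintype.piFinset (fun _ : Fin r => Aᶜ) := by
    ext f
    simp only [mem_filter, mem_univ, true_and, Fintype.mem_piFinset, mem_compl]
    rw [Finset.disjoint_right]
    simp
  rw [this]
  simp [Fintype.card_piFinset, card_compl]

/-- Averaging over `r` independent uniformly random sets: some family of at most `r` sets, added
to `T₀`, does at least as well as the average. -/
theorem exists_union_hitWeight_ge (hn : 0 < n) (w : ι → ℕ) (K : ι → Finset (Fin n))
    (T₀ : Finset (Fin n)) (r : ℕ) :
    ∃ R : Finset (Fin n), #R ≤ r ∧
      ∑ v, (w v : ℝ) * (if Disjoint (K v) T₀ then 1 - (1 - (#(K v) : ℝ) / n) ^ r else 1) ≤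
        hitWeight w K (T₀ ∪ R) := by
  have : NeZero n := ⟨hn.ne'⟩
  have hn' : (0 : ℝ) < n := by exact_mod_cast hn
  have key : ∑ f : Fin r → Fin n, (hitWeight w K (T₀ ∪ univ.image f) : ℝ) =
      ∑ f : Fin r → Fin n,
        ∑ v, (w v : ℝ) * (if Disjoint (K v) T₀ then 1 - (1 - (#(K v) : ℝ) / n) ^ r else 1) := by
    have hL : ∀ f : Fin r → Fin n, (hitWeight w K (T₀ ∪ univ.image f) : ℝ) =
        ∑ v, (w v : ℝ) * (if Disjoint (K v) T₀ then
          (1 - if Disjoint (K v) (univ.image f) then (1 : ℝ) else 0) else 1) := by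
      intro f
      unfold hitWeight
      push_cast
      refine sum_congr rfl fun v _ => ?_
      by_cases h1 : Disjoint (K v) T₀ <;> by_cases h2 : Disjoint (K v) (univ.image f) <;>
        simp [h1, h2, Finset.disjoint_union_right]
    simp_rw [hL]
    rw [sum_comm, sum_comm (s := (univ : Finset (Fin r → Fin n)))]
    refine sum_congr rfl fun v _ => ?_
    rw [← mul_sum, ← mul_sum]
    congr 1
    by_cases h1 : Disjoint (K v) T₀
    · simp only [h1, if_true, sum_sub_distrib]
      congr 1
      rw [← sum_filter, sum_const, card_filter_avoid, sum_const, card_univ]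
      have : #(K v) ≤ n := by simpa using card_le_univ (K v)
      simp only [Fintype.card_fun, Fintype.card_fin, nsmul_eq_mul, mul_one]
      push_cast [Nat.cast_sub this]
      rw [← mul_pow]
      congr 1
      field_simp
    · simp [h1]
  obtain ⟨f, -, hf⟩ := exists_le_of_sum_le (s := (univ : Finset (Fin r → Fin n)))
    univ_nonempty key.ge
  exact ⟨univ.image f, by simpa using card_image_le (s := univ) (f := f), hf⟩

theorem one_sub_pow_le_exp {x : ℝ} (hx : x ≤ 1) (r : ℕ) :
    (1 - x) ^ r ≤ Real.exp (-(r * x)) := by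
  calc (1 - x) ^ r ≤ Real.exp (-x) ^ r :=
        pow_le_pow_left₀ (by linarith) (by linarith [Real.add_one_le_exp (-x)]) r
    _ = Real.exp (-(r * x)) := by rw [← Real.exp_nat_mul]; congr 1; ring

/-- A random choice of `k` sets hits an element of degree `d` with probability at least
`x / (1 + x)`, where `x = k d / n`. -/
theorem exists_hitWeight_ge_sum_degree (hn : 0 < n) (w : ι → ℕ) (K : ι → Finset (Fin n)) {k c : ℕ}
    (hk : k ≤ n) (hK : ∀ v, k * #(K v) ≤ c * n) :
    ∃ T : Finset (Fin n), #T = k ∧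
      k * ∑ v, w v * #(K v) ≤ (c + 1) * n * hitWeight w K T := by
  obtain ⟨R, hR, h⟩ := exists_union_hitWeight_ge hn w K ∅ k
  obtain ⟨T, hRT, hT⟩ := exists_superset_card_eq hR (by simpa using hk)
  refine ⟨T, hT, ?_⟩
  have hn' : (0 : ℝ) < n := by exact_mod_cast hn
  have h2 : (hitWeight w K (∅ ∪ R) : ℝ) ≤ hitWeight w K T := by
    exact_mod_cast hitWeight_mono_right w K (by simpa using hRT)
  have h3 := h.trans h2
  suffices hs : (k : ℝ) * ∑ v, (w v : ℝ) * #(K v) ≤ (c + 1) * n * hitWeight w K T by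
    exact_mod_cast hs
  refine le_trans ?_ (mul_le_mul_of_nonneg_left h3 (by positivity))
  rw [mul_sum, mul_sum]
  refine sum_le_sum fun v _ => ?_
  simp only [disjoint_empty_right, if_true]
  have hd : (#(K v) : ℝ) / n ≤ 1 := by
    rw [div_le_one hn']
    exact_mod_cast by simpa using card_le_univ (K v)
  obtain ⟨x, hx⟩ : ∃ x : ℝ, x = (#(K v) : ℝ) / n := ⟨_, rfl⟩
  rw [← hx] at hd ⊢
  have hx0 : 0 ≤ x := by rw [hx]; positivity
  have hkx : (k : ℝ) * x ≤ c := by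
    rw [hx, ← mul_div_assoc, div_le_iff₀ hn']
    exact_mod_cast hK v
  have hdx : (#(K v) : ℝ) = x * n := by rw [hx, div_mul_cancel₀ _ hn'.ne']
  have hp : (1 - x) ^ k ≤ 1 / (1 + k * x) := by
    have h1 := one_sub_pow_le_exp hd k
    refine h1.trans ?_
    rw [Real.exp_neg, ← one_div]
    apply one_div_le_one_div_of_le (by positivity)
    linarith [Real.add_one_le_exp ((k : ℝ) * x)]
  have hp2 : k * x / (1 + k * x) ≤ 1 - (1 - x) ^ k := by
    have : k * x / (1 + k * x) = 1 - 1 / (1 + k * x) := by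
      rw [eq_sub_iff_add_eq, ← add_div, add_comm, div_self (by positivity)]
    linarith
  have hp3 : (k : ℝ) * x ≤ (c + 1) * (1 - (1 - x) ^ k) := by
    rw [div_le_iff₀ (by positivity)] at hp2
    have hpos : 0 ≤ 1 - (1 - x) ^ k := by
      have : (1 - x) ^ k ≤ 1 := pow_le_one₀ (by linarith) (by linarith)
      linarith
    nlinarith
  rw [hdx]
  calc (k : ℝ) * (w v * (x * n)) = (w v * n) * (k * x) := by ring
    _ ≤ (w v * n) * ((c + 1) * (1 - (1 - x) ^ k)) := by gcongr
    _ = _ := by ring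

/-- Dropping sets one at a time, always one with the least marginal contribution, keeps the
average contribution per set. -/
theorem exists_subset_hitWeight_ge (w : ι → ℕ) (K : ι → Finset (Fin n)) (O : Finset (Fin n))
    (r : ℕ) (hr : r ≤ #O) :
    ∃ T ⊆ O, #T = #O - r ∧ (#O - r) * hitWeight w K O ≤ #O * hitWeight w K T := by
  induction r with
  | zero => exact ⟨O, Subset.rfl, by simp, by simp⟩
  | succ r ih =>
    obtain ⟨T, hTO, hT, hw⟩ := ih (by omega)
    have hTpos : T.Nonempty := by rw [← card_pos]; omega
    have key : #T * ((#T - 1) * hitWeight w K T) ≤ ∑ x ∈ T, #T * hitWeight w K (T.erase x) := by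
      rw [← mul_sum]
      refine Nat.mul_le_mul_left _ ?_
      unfold hitWeight
      rw [sum_comm, mul_sum]
      refine sum_le_sum fun v _ => ?_
      by_cases h : Disjoint (K v) T
      · simp [h]
      · obtain ⟨y, hyK, hyT⟩ := not_disjoint_iff.mp h
        simp only [h, if_false]
        calc (#T - 1) * w v = ∑ x ∈ T.erase y, w v := by simp [card_erase_of_mem hyT]
          _ = ∑ x ∈ T.erase y, if Disjoint (K v) (T.erase x) then 0 else w v := by
              refine sum_congr rfl fun x hx => ?_
              rw [if_neg]
              exact not_disjoint_iff.mpr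
                ⟨y, hyK, mem_erase.mpr ⟨fun hh => (mem_erase.mp hx).1 hh.symm, hyT⟩⟩
          _ ≤ _ := sum_le_sum_of_subset (erase_subset y T)
    have : ∑ x ∈ T, (#T - 1) * hitWeight w K T ≤ ∑ x ∈ T, #T * hitWeight w K (T.erase x) := by
      rw [sum_const, smul_eq_mul]; exact key
    obtain ⟨x, hx, hle⟩ := exists_le_of_sum_le hTpos this
    refine ⟨T.erase x, (erase_subset _ _).trans hTO, by rw [card_erase_of_mem hx]; omega, ?_⟩
    have e1 : #T - 1 = #O - (r + 1) := by omega
    rw [e1] at hle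
    have hTp : 0 < #T := hTpos.card_pos
    rw [← hT] at hw
    refine le_of_mul_le_mul_left (a := #T) ?_ hTp
    calc #T * ((#O - (r + 1)) * hitWeight w K O)
        = (#O - (r + 1)) * (#T * hitWeight w K O) := by ring
      _ ≤ (#O - (r + 1)) * (#O * hitWeight w K T) := Nat.mul_le_mul_left _ hw
      _ = #O * ((#O - (r + 1)) * hitWeight w K T) := by ring
      _ ≤ #O * (#T * hitWeight w K (T.erase x)) := Nat.mul_le_mul_left _ hle
      _ = _ := by ring

/-- Capping all degrees at `D > 20 n / k` costs at most a fifth of the weight: a fifth of an optimal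
family is traded for random sets, which hit an element of capped degree with probability at
least `1 - exp (-2)`. -/
theorem exists_hitWeight_ge_of_capped (hn : 0 < n) (w : ι → ℕ) {K N : ι → Finset (Fin n)}
    {k D : ℕ} (hkD : 20 * n < k * D) (hKN : ∀ v, K v ⊆ N v)
    (hcard : ∀ v, #(K v) = min D #(N v)) {O : Finset (Fin n)} (hO : #O = k) :
    ∃ T : Finset (Fin n), #T = k ∧ 4 * hitWeight w N O ≤ 5 * hitWeight w K T := by
  have hk : k ≤ n := by rw [← hO]; simpa using card_le_univ O
  have hn' : (0 : ℝ) < n := by exact_mod_cast hn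
  have hsmall : ∀ v, #(N v) ≤ D → K v = N v := fun v hv =>
    eq_of_subset_of_card_le (hKN v) (by rw [hcard v]; omega)
  rcases le_or_gt k 20 with hk20 | hk20
  · -- for `k ≤ 20` the cap exceeds `n` and nothing is cut
    refine ⟨O, hO, ?_⟩
    have hD : n ≤ D := by nlinarith
    have : K = N := funext fun v => hsmall v (le_trans (by simpa using card_le_univ (N v)) hD)
    rw [this]; omega
  -- `r` sets of `O` are traded for random ones
  set r := k / 5 with hr
  -- the light elements are those whose degree is not cut
  set wl : ι → ℕ := fun v => if #(N v) ≤ D then w v else 0 with hwl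
  obtain ⟨O', hO'O, hO'c, hO'w⟩ := exists_subset_hitWeight_ge wl N O r (by omega)
  obtain ⟨R, hR, h⟩ := exists_union_hitWeight_ge hn w K O' r
  have hcardu : #(O' ∪ R) ≤ k := (card_union_le _ _).trans (by omega)
  obtain ⟨T, hRT, hT⟩ := exists_superset_card_eq hcardu (by simpa using hk)
  refine ⟨T, hT, ?_⟩
  have h2 : (hitWeight w K (O' ∪ R) : ℝ) ≤ hitWeight w K T := by
    exact_mod_cast hitWeight_mono_right w K hRT
  have hl : (4 / 5 : ℝ) * hitWeight wl N O ≤ hitWeight wl N O' := by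
    rw [hO] at hO'w
    have h1 : 4 * k ≤ 5 * (k - r) := by omega
    have h3 : k * (4 * hitWeight wl N O) ≤ k * (5 * hitWeight wl N O') := by
      calc k * (4 * hitWeight wl N O) = 4 * k * hitWeight wl N O := by ring
        _ ≤ 5 * (k - r) * hitWeight wl N O := Nat.mul_le_mul_right _ h1
        _ = 5 * ((k - r) * hitWeight wl N O) := by ring
        _ ≤ 5 * (k * hitWeight wl N O') := Nat.mul_le_mul_left _ hO'w
        _ = _ := by ring
    have h4 := Nat.le_of_mul_le_mul_left h3 (by omega)
    have h5 : (4 : ℝ) * hitWeight wl N O ≤ 5 * hitWeight wl N O' := by exact_mod_cast h4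
    linarith
  suffices hs : (4 / 5 : ℝ) * hitWeight w N O ≤ hitWeight w K T by
    have : (4 : ℝ) * hitWeight w N O ≤ 5 * hitWeight w K T := by linarith
    exact_mod_cast this
  -- a heavy element is missed by `r` random sets with probability at most `1 / 5`
  have hheavy : ∀ v, D < #(N v) → (1 - (#(K v) : ℝ) / n) ^ r ≤ 1 / 5 := by
    intro v hv
    have hKD : #(K v) = D := by rw [hcard v]; omega
    have hDn : (D : ℝ) / n ≤ 1 := by
      rw [div_le_one hn']
      have : #(N v) ≤ n := by simpa using card_le_univ (N v)
      exact_mod_cast by omega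
    rw [hKD]
    have h1 := one_sub_pow_le_exp hDn r
    have h2 : (2 : ℝ) ≤ r * (D / n) := by
      rw [← mul_div_assoc, le_div_iff₀ hn']
      have h3 : k ≤ 10 * r := by omega
      have : 2 * n ≤ r * D := by nlinarith
      exact_mod_cast this
    have h3 : Real.exp (-(r * ((D : ℝ) / n))) ≤ Real.exp (-2) :=
      Real.exp_le_exp.mpr (by linarith)
    have h4 : Real.exp (-2) ≤ 1 / 5 := by
      rw [Real.exp_neg, ← one_div]
      apply one_div_le_one_div_of_le (by norm_num)
      have : Real.exp 2 = Real.exp 1 * Real.exp 1 := by rw [← Real.exp_add]; norm_num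
      have := Real.exp_one_gt_d9
      nlinarith
    linarith
  have hx : (4 / 5 : ℝ) * hitWeight w N O ≤ (4 / 5 : ℝ) * hitWeight wl N O +
      ∑ v, if #(N v) ≤ D then (0 : ℝ) else 4 / 5 * w v := by
    unfold hitWeight
    push_cast
    rw [mul_sum, mul_sum, ← sum_add_distrib]
    refine sum_le_sum fun v _ => ?_
    simp only [hwl]
    by_cases a1 : Disjoint (N v) O <;> by_cases a2 : #(N v) ≤ D <;> simp [a1, a2]
  have hy : (hitWeight wl N O' : ℝ) + (∑ v, if #(N v) ≤ D then (0 : ℝ) else 4 / 5 * w v) ≤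
      ∑ v, (w v : ℝ) * (if Disjoint (K v) O' then 1 - (1 - (#(K v) : ℝ) / n) ^ r else 1) := by
    unfold hitWeight
    push_cast
    rw [← sum_add_distrib]
    refine sum_le_sum fun v _ => ?_
    simp only [hwl]
    have hd : (#(K v) : ℝ) / n ≤ 1 := by
      rw [div_le_one hn']
      exact_mod_cast by simpa using card_le_univ (K v)
    have hpos : (0 : ℝ) ≤ 1 - (1 - (#(K v) : ℝ) / n) ^ r := by
      have h0 : (0 : ℝ) ≤ (#(K v) : ℝ) / n := by positivity
      have : (1 - (#(K v) : ℝ) / n) ^ r ≤ 1 := pow_le_one₀ (by linarith) (by linarith)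
      linarith
    have hwv : (0 : ℝ) ≤ w v := by positivity
    by_cases a2 : #(N v) ≤ D
    · rw [hsmall v a2] at hpos ⊢
      by_cases a1 : Disjoint (N v) O'
      · simp only [a1, a2, if_true]; simpa using mul_nonneg hwv hpos
      · simp [a1, a2]
    · have := hheavy v (by omega)
      by_cases a1 : Disjoint (K v) O'
      · simp only [a1, a2, if_true, if_false]
        have h6 : (4 / 5 : ℝ) ≤ 1 - (1 - (#(K v) : ℝ) / n) ^ r := by linarith
        have := mul_le_mul_of_nonneg_left h6 hwv
        split_ifs <;> push_cast <;> linarith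
      · simp only [a1, a2, if_false]
        split_ifs <;> push_cast <;> linarith
  linarith

end Hit

/-! ### Concentration for independent threshold samples -/

section Sampling

variable {Ω ι : Type*} [Fintype Ω] [Fintype ι]

/-- The numbers `u ω v`, for uniformly random `ω`, are independent over `v` and uniform
in `{0, …, N - 1}`; encoded as multiplicativity of expectations of products. -/
def UniformIndep (N : ℕ) (u : Ω → ι → ℕ) : Prop :=
  ∀ g : ι → ℕ → ℝ, ∑ ω, ∏ v, g v (u ω v) =
    Fintype.card Ω * ∏ v, ((∑ x ∈ range N, g v x) / N)

/-- Some coordinates of a uniformly random function are themselves uniform and independent. -/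
theorem sum_prod_comp_injective {J β : Type*} [Fintype J] [DecidableEq J] [Fintype β] [Nonempty β]
    {e : ι → J} (he : Function.Injective e) (g : ι → β → ℝ) :
    ∑ f : J → β, ∏ v, g v (f (e v)) =
      Fintype.card (J → β) * ∏ v, ((∑ x, g v x) / Fintype.card β) := by
  have hβ : (Fintype.card β : ℝ) ≠ 0 := by exact_mod_cast Fintype.card_ne_zero
  set h : J → β → ℝ := Function.extend e g (fun _ _ => 1) with hh
  have h1 : ∀ f : J → β, ∏ v, g v (f (e v)) = ∏ j, h j (f j) := fun f => by
    refine Fintype.prod_of_injective e he _ _ (fun j hj => ?_) (fun v => ?_)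
    · rw [hh, Function.extend_apply' _ _ _ (by simpa using hj)]
    · rw [hh, he.extend_apply]
  have h2 : ∏ v, ((∑ x, g v x) / (Fintype.card β : ℝ)) =
      ∏ j, ((∑ x, h j x) / (Fintype.card β : ℝ)) := by
    refine Fintype.prod_of_injective e he _ _ (fun j hj => ?_) (fun v => ?_)
    · rw [hh, Function.extend_apply' _ _ _ (by simpa using hj)]
      simp [hβ]
    · rw [hh, he.extend_apply]
  simp_rw [h1, h2]
  rw [prod_div_distrib, prod_const, card_univ, Fintype.card_fun, prod_univ_sum,
    Fintype.piFinset_univ]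
  push_cast
  field_simp

theorem sum_sampled_weight {N : ℕ} (hN : 0 < N) (t : ℕ) (y : ℝ) :
    (∑ x ∈ range N, (if x < t then y else 1)) / N = 1 + (min t N : ℕ) / N * (y - 1) := by
  have hN' : (N : ℝ) ≠ 0 := by positivity
  have : ∀ x, (if x < t then y else 1) = 1 + if x < t then y - 1 else 0 := by
    intro x; split_ifs <;> ring
  simp_rw [this]
  rw [sum_add_distrib, ← sum_filter, sum_const, sum_const]
  have : #{x ∈ range N | x < t} = min t N := by
    have : ({x ∈ range N | x < t} : Finset ℕ) = range (min t N) := by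
      ext x; simp; tauto
    rw [this, card_range]
  rw [this]
  simp only [card_range, nsmul_eq_mul, mul_one]
  field_simp

/-- Exponential Markov inequality: `b v` bounds the logarithmic moment generating function of the
contribution of `v`. -/
theorem UniformIndep.card_tail_le {N : ℕ} (hN : 0 < N) {u : Ω → ι → ℕ} (hu : UniformIndep N u)
    (t : ι → ℕ) (c b : ι → ℝ) (τ : ℝ)
    (hb : ∀ v, 1 + (min (t v) N : ℕ) / N * (Real.exp (c v) - 1) ≤ Real.exp (b v)) :
    (#{ω | τ ≤ ∑ v, if u ω v < t v then c v else 0} : ℝ) ≤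
      Fintype.card Ω * Real.exp (∑ v, b v - τ) := by
  have h1 : ∑ ω, Real.exp (∑ v, if u ω v < t v then c v else 0) ≤
      Fintype.card Ω * Real.exp (∑ v, b v) := by
    have := hu (fun v x => if x < t v then Real.exp (c v) else 1)
    simp_rw [sum_sampled_weight hN] at this
    have h2 : ∀ ω, Real.exp (∑ v, if u ω v < t v then c v else 0) =
        ∏ v, if u ω v < t v then Real.exp (c v) else 1 := by
      intro ω
      rw [Real.exp_sum]
      refine prod_congr rfl fun v _ => ?_
      split_ifs <;> simp
    simp_rw [h2]
    rw [this, Real.exp_sum]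
    gcongr with v
    · intro v _
      have hp : ((min (t v) N : ℕ) : ℝ) / N ≤ 1 := by
        rw [div_le_one (by positivity)]
        exact_mod_cast min_le_right _ _
      have hp0 : (0 : ℝ) ≤ ((min (t v) N : ℕ) : ℝ) / N := by positivity
      nlinarith [Real.exp_pos (c v)]
    · exact hb v
  have h3 : (#{ω | τ ≤ ∑ v, if u ω v < t v then c v else 0} : ℝ) * Real.exp τ ≤
      ∑ ω, Real.exp (∑ v, if u ω v < t v then c v else 0) := by
    rw [← nsmul_eq_mul]
    refine le_trans (card_nsmul_le_sum _ _ _ ?_)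
      (sum_le_sum_of_subset_of_nonneg (filter_subset _ _) fun _ _ _ => (Real.exp_pos _).le)
    intro ω hω
    exact Real.exp_le_exp.mpr (mem_filter.mp hω).2
  rw [Real.exp_sub, ← mul_div_assoc, le_div_iff₀ (Real.exp_pos τ)]
  exact h3.trans h1

theorem exp_sub_one_le {x : ℝ} (hx : |x| ≤ 1) : Real.exp x - 1 ≤ x + x ^ 2 := by
  have := (abs_le.mp (Real.abs_exp_sub_one_sub_id_le hx)).2
  linarith

theorem one_add_sampled_le {N t : ℕ} (hN : 0 < N) {y z : ℝ} (hy : y ≤ z) (hz : 0 ≤ z) :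
    1 + (min t N : ℕ) / N * y ≤ Real.exp (z * t / N) := by
  have hp : ((min t N : ℕ) : ℝ) / N ≤ t / N := by
    gcongr
    exact min_le_left _ _
  have h0 : (0 : ℝ) ≤ ((min t N : ℕ) : ℝ) / N := by positivity
  have : ((min t N : ℕ) : ℝ) / N * y ≤ t / N * z :=
    (mul_le_mul_of_nonneg_left hy h0).trans (mul_le_mul_of_nonneg_right hp hz)
  have h3 := Real.add_one_le_exp (z * t / N)
  have h4 : (t : ℝ) / N * z = z * t / N := by ring
  linarith

/-- Upper tail of the total size of the sampled elements, for sizes in `[0, A]`. -/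
theorem UniformIndep.card_sampled_size_ge_le {N : ℕ} (hN : 0 < N) {u : Ω → ι → ℕ}
    (hu : UniformIndep N u) (t : ι → ℕ) (s : ι → ℕ) {A : ℕ} (hA : 0 < A) (hs : ∀ v, s v ≤ A)
    (τ : ℝ) :
    (#{ω | τ ≤ ((∑ v, if u ω v < t v then s v else 0 : ℕ) : ℝ)} : ℝ) ≤
      Fintype.card Ω * Real.exp ((2 * (∑ v, (s v : ℝ) * t v / N) - τ) / A) := by
  have hA' : (0 : ℝ) < A := by exact_mod_cast hA
  have h := hu.card_tail_le hN t (fun v => (s v : ℝ) / A)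
    (fun v => 2 * ((s v : ℝ) / A) * t v / N) (τ / A) (by
      intro v
      have h0 : (0 : ℝ) ≤ (s v : ℝ) / A := by positivity
      have h1 : (s v : ℝ) / A ≤ 1 := by
        rw [div_le_one hA']
        exact_mod_cast hs v
      refine one_add_sampled_le hN ?_ (by positivity)
      have := exp_sub_one_le (x := (s v : ℝ) / A) (by rw [abs_of_nonneg h0]; exact h1)
      nlinarith)
  have e1 : ∑ v, 2 * ((s v : ℝ) / A) * t v / N - τ / A =
      (2 * (∑ v, (s v : ℝ) * t v / N) - τ) / A := by
    rw [sub_div, mul_sum, sum_div]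
    congr 1
    refine sum_congr rfl fun v _ => ?_
    ring
  rw [e1] at h
  refine le_trans (le_of_eq ?_) h
  congr 2
  ext ω
  simp only [mem_filter, mem_univ, true_and]
  rw [div_le_iff₀ hA', sum_mul]
  push_cast
  have : ∀ v, (if u ω v < t v then (s v : ℝ) / A else 0) * A =
      if u ω v < t v then (s v : ℝ) else 0 := by
    intro v; split_ifs <;> field_simp
    simp
  simp_rw [this]

/-- An unbiased estimate of the total of the thresholds `t v` over the elements in `H`: an element
sampled with probability `t v / N < 1` counts `N`, and one sampled with certainty counts `t v`. -/
def sampleScore (N : ℕ) (t : ι → ℕ) (H : ι → Prop) [DecidablePred H] (x : ι → ℕ) : ℕ :=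
  ∑ v, if x v < t v ∧ H v then max N (t v) else 0

/-- Both exponential tail bounds for the estimate, the upper one for `s > 0` and the lower one for
`s < 0`. Elements sampled with certainty contribute no deviation, all others at most `1`. -/
theorem UniformIndep.card_score_tail_le {N : ℕ} (hN : 0 < N) {u : Ω → ι → ℕ}
    (hu : UniformIndep N u) (t : ι → ℕ) (H : ι → Prop) [DecidablePred H] {s : ℝ} (hs : |s| ≤ 1)
    (τ : ℝ) :
    (#{ω | τ ≤ s * (sampleScore N t H (u ω) / N : ℝ)} : ℝ) ≤
      Fintype.card Ω *
        Real.exp ((s + s ^ 2) * ((∑ v, if H v then t v else 0 : ℕ) / N : ℝ) - τ) := by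
  have hN' : (0 : ℝ) < N := by exact_mod_cast hN
  have h := hu.card_tail_le hN t (fun v => if H v then s * ((max N (t v) : ℕ) / N : ℝ) else 0)
    (fun v => if H v then (s + s ^ 2) * (t v : ℝ) / N else 0) τ (by
      intro v
      by_cases hv : H v
      · simp only [hv, if_true]
        rcases le_total N (t v) with htN | htN
        · rw [min_eq_right htN, max_eq_right htN, div_self hN'.ne', one_mul]
          have h1 : 1 + (Real.exp (s * (t v / N : ℝ)) - 1) = Real.exp (s * (t v / N : ℝ)) := by
            ring
          rw [h1]
          apply Real.exp_le_exp.mpr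
          have : 0 ≤ s ^ 2 * (t v / N : ℝ) := by positivity
          calc s * (t v / N : ℝ) ≤ s * (t v / N : ℝ) + s ^ 2 * (t v / N : ℝ) := by linarith
            _ = _ := by ring
        · rw [max_eq_left htN, div_self hN'.ne', mul_one, min_eq_left htN]
          have h1 := exp_sub_one_le hs
          have h2 := mul_le_mul_of_nonneg_left h1 (show (0 : ℝ) ≤ (t v : ℝ) / N by positivity)
          have h3 := Real.add_one_le_exp ((s + s ^ 2) * (t v : ℝ) / N)
          have h4 : (t v : ℝ) / N * (s + s ^ 2) = (s + s ^ 2) * (t v : ℝ) / N := by ring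
          linarith
      · simp [hv])
  have e1 : ∑ v, (if H v then (s + s ^ 2) * (t v : ℝ) / N else 0) =
      (s + s ^ 2) * ((∑ v, if H v then t v else 0 : ℕ) / N : ℝ) := by
    push_cast
    rw [sum_div, mul_sum]
    refine sum_congr rfl fun v _ => ?_
    split_ifs <;> ring
  rw [e1] at h
  refine le_trans (le_of_eq ?_) h
  congr 2
  ext ω
  simp only [mem_filter, mem_univ, true_and]
  have : s * (sampleScore N t H (u ω) / N : ℝ) = ∑ v, if u ω v < t v then
      (if H v then s * ((max N (t v) : ℕ) / N : ℝ) else 0) else 0 := by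
    unfold sampleScore
    push_cast
    rw [sum_div, mul_sum]
    refine sum_congr rfl fun v _ => ?_
    by_cases h1 : u ω v < t v <;> by_cases h2 : H v <;> simp [h1, h2]
  rw [this]

/-- Two-sided concentration: the estimate divided by `N` deviates from its mean by a tenth of an
upper bound `μ` of the mean with exponentially small probability. -/
theorem UniformIndep.card_score_deviation_le {N : ℕ} (hN : 0 < N) {u : Ω → ι → ℕ}
    (hu : UniformIndep N u) (t : ι → ℕ) (H : ι → Prop) [DecidablePred H] {μ : ℝ}
    (hμ : ((∑ v, if H v then t v else 0 : ℕ) / N : ℝ) ≤ μ) :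
    (#{ω | μ / 10 ≤ |(sampleScore N t H (u ω) / N : ℝ) -
        (∑ v, if H v then t v else 0 : ℕ) / N|} : ℝ) ≤
      2 * (Fintype.card Ω * Real.exp (-(μ / 400))) := by
  classical
  obtain ⟨x, hx⟩ : ∃ x : ℝ, x = ((∑ v, if H v then t v else 0 : ℕ) / N : ℝ) := ⟨_, rfl⟩
  have h1 := hu.card_score_tail_le hN t H (s := 1 / 20) (by norm_num [abs_le])
    (1 / 20 * (x + μ / 10))
  have h2 := hu.card_score_tail_le hN t H (s := -(1 / 20)) (by norm_num [abs_le])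
    (-(1 / 20) * (x - μ / 10))
  rw [← hx] at h1 h2 hμ ⊢
  have e1 : Real.exp ((1 / 20 + (1 / 20) ^ 2) * x - 1 / 20 * (x + μ / 10)) ≤
      Real.exp (-(μ / 400)) := Real.exp_le_exp.mpr (by nlinarith)
  have e2 : Real.exp ((-(1 / 20) + (-(1 / 20)) ^ 2) * x - -(1 / 20) * (x - μ / 10)) ≤
      Real.exp (-(μ / 400)) := Real.exp_le_exp.mpr (by nlinarith)
  have hc : (0 : ℝ) ≤ Fintype.card Ω := by positivity
  have f1 := h1.trans (mul_le_mul_of_nonneg_left e1 hc)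
  have f2 := h2.trans (mul_le_mul_of_nonneg_left e2 hc)
  have hsub : ({ω | μ / 10 ≤ |(sampleScore N t H (u ω) / N : ℝ) - x|} : Finset Ω) ⊆
      ({ω | 1 / 20 * (x + μ / 10) ≤ 1 / 20 * (sampleScore N t H (u ω) / N : ℝ)} : Finset Ω) ∪
      ({ω | -(1 / 20) * (x - μ / 10) ≤ -(1 / 20) * (sampleScore N t H (u ω) / N : ℝ)} :
        Finset Ω) := by
    intro ω
    simp only [mem_filter, mem_univ, true_and, mem_union, le_abs]
    rintro (h | h)
    · left; linarith
    · right; linarith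
  have h3 := (card_le_card hsub).trans (card_union_le _ _)
  have h4 : (#{ω | μ / 10 ≤ |(sampleScore N t H (u ω) / N : ℝ) - x|} : ℝ) ≤
      (#{ω | 1 / 20 * (x + μ / 10) ≤ 1 / 20 * (sampleScore N t H (u ω) / N : ℝ)} : ℝ) +
      (#{ω | -(1 / 20) * (x - μ / 10) ≤ -(1 / 20) * (sampleScore N t H (u ω) / N : ℝ)} : ℝ) := by
    exact_mod_cast h3
  linarith

end Sampling

/-! ### The sample determines a near-optimal family -/

/-- The bound `B = O(n log n)` on the number of edges collected, which is also the largest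
sampling rate. The constant makes the failure probability of a single estimate, which is
`2 * exp (-μ / 400)` with `μ ≥ B * k / (176 * n)`, at most `2 * exp (-28 * k * Nat.size n)`; this
outweighs the number of pairs of a family and a rate. -/
def edgeBudget (n : ℕ) : ℕ := 2000000 * n * Nat.size n

section Quality

variable {Ω ι : Type*} [Fintype Ω] [Fintype ι] {n : ℕ}

/-- The number of edges collected at sampling rate `q`. -/
def sampledEdges (w d : ι → ℕ) (x : ι → ℕ) (q : ℕ) : ℕ :=
  ∑ v, if x v < q * w v then d v else 0

/-- The largest rate, up to `B`, at which at most `B` edges are collected. -/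
def sampleRate (w d : ι → ℕ) (B : ℕ) (x : ι → ℕ) : ℕ :=
  Nat.findGreatest (fun q => sampledEdges w d x q ≤ B) B

/-- The estimate of `q * hitWeight w K T` from the sample at rate `q`. -/
def familyScore (N : ℕ) (w : ι → ℕ) (K : ι → Finset (Fin n)) (q : ℕ) (x : ι → ℕ)
    (T : Finset (Fin n)) : ℕ :=
  sampleScore N (fun v => q * w v) (fun v => ¬ Disjoint (K v) T) x

theorem cast_le_exp (a : ℕ) : (a : ℝ) ≤ Real.exp a := by
  linarith [Real.add_one_le_exp (a : ℝ)]

theorem cast_le_exp_size (a : ℕ) : (a : ℝ) ≤ Real.exp (Nat.size a) := by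
  have h1 : (a : ℝ) ≤ 2 ^ Nat.size a := by exact_mod_cast (Nat.lt_size_self a).le
  have h2 : (2 : ℝ) ^ Nat.size a ≤ Real.exp 1 ^ Nat.size a := by
    gcongr
    linarith [Real.exp_one_gt_d9]
  rw [← Real.exp_nat_mul, mul_one] at h2
  exact h1.trans h2

theorem exp_neg_two_size_le {a : ℕ} (ha : 0 < a) :
    Real.exp (-(2 * Nat.size a)) ≤ 1 / (a * a) := by
  have ha' : (0 : ℝ) < a := by exact_mod_cast ha
  rw [Real.exp_neg, ← one_div]
  apply one_div_le_one_div_of_le (by positivity)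
  rw [two_mul, Real.exp_add]
  have := cast_le_exp_size a
  gcongr

/-- With high probability only `O(B)` elements are sampled at rate `B`. -/
theorem UniformIndep.card_many_samples_le {N : ℕ} {u : Ω → ι → ℕ} (hu : UniformIndep N u)
    (hn : 3 ≤ n) (w : ι → ℕ) (hN : ∑ v, w v < N) :
    (n : ℝ) * #{ω | 4 * edgeBudget n ≤ #{v | u ω v < edgeBudget n * w v}} ≤ Fintype.card Ω := by
  have hN0 : 0 < N := by omega
  have hN' : (0 : ℝ) < N := by exact_mod_cast hN0
  have hn' : (3 : ℝ) ≤ n := by exact_mod_cast hn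
  have h := hu.card_sampled_size_ge_le hN0 (fun v => edgeBudget n * w v) (fun _ => 1) one_pos
    (fun _ => le_rfl) ((4 * edgeBudget n : ℕ) : ℝ)
  have hset : ({ω | 4 * edgeBudget n ≤ #{v | u ω v < edgeBudget n * w v}} : Finset Ω) =
      ({ω | ((4 * edgeBudget n : ℕ) : ℝ) ≤
        ((∑ v, if u ω v < edgeBudget n * w v then 1 else 0 : ℕ) : ℝ)} : Finset Ω) := by
    ext ω
    simp only [mem_filter, mem_univ, true_and, Nat.cast_le]
    rw [card_filter]
  rw [hset]
  have hsum : ∑ v, ((1 : ℕ) : ℝ) * ((edgeBudget n * w v : ℕ) : ℝ) / N ≤ edgeBudget n := by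
    have : ∑ v, ((1 : ℕ) : ℝ) * ((edgeBudget n * w v : ℕ) : ℝ) / N =
        edgeBudget n * ((∑ v, w v : ℕ) / N : ℝ) := by
      push_cast
      rw [sum_div, mul_sum]
      exact sum_congr rfl fun v _ => by ring
    rw [this]
    have h1 : ((∑ v, w v : ℕ) / N : ℝ) ≤ 1 := by
      rw [div_le_one hN']
      exact_mod_cast hN.le
    nlinarith [show (0 : ℝ) ≤ edgeBudget n by positivity]
  have hB : (2 * Nat.size n : ℝ) ≤ edgeBudget n := by
    have : 2 * Nat.size n ≤ edgeBudget n := by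
      unfold edgeBudget
      exact Nat.mul_le_mul_right _ (by omega)
    exact_mod_cast this
  have hexp : Real.exp ((2 * (∑ v, ((1 : ℕ) : ℝ) * ((edgeBudget n * w v : ℕ) : ℝ) / N) -
      ((4 * edgeBudget n : ℕ) : ℝ)) / ((1 : ℕ) : ℝ)) ≤ 1 / (n * n) := by
    refine le_trans (Real.exp_le_exp.mpr ?_) (exp_neg_two_size_le (by omega))
    push_cast at hsum ⊢
    linarith
  calc (n : ℝ) * _ ≤ n * (Fintype.card Ω * (1 / (n * n))) := by
        refine mul_le_mul_of_nonneg_left (h.trans ?_) (by positivity)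
        exact mul_le_mul_of_nonneg_left hexp (by positivity)
    _ = Fintype.card Ω * (1 / n) := by field_simp
    _ ≤ Fintype.card Ω * 1 := by
        gcongr
        rw [div_le_one (by linarith)]
        linarith
    _ = _ := mul_one _

/-- `T` has the best score among the families of `k` sets. -/
def IsBestFamily (N : ℕ) (w : ι → ℕ) (K : ι → Finset (Fin n)) (k q : ℕ) (x : ι → ℕ)
    (T : Finset (Fin n)) : Prop :=
  #T = k ∧ ∀ T' : Finset (Fin n), #T' = k → familyScore N w K q x T' ≤ familyScore N w K q x T

/-- If no estimate deviates much at rate `q`, the best family in the sample is near-optimal. -/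
theorem IsBestFamily.four_mul_le {N k q : ℕ} {w : ι → ℕ} {K : ι → Finset (Fin n)} {x : ι → ℕ}
    {T O : Finset (Fin n)} (hN : 0 < N) (hq : 0 < q) (hT : IsBestFamily N w K k q x T)
    (hO : #O = k)
    (hdev : ∀ T' : Finset (Fin n), #T' = k →
      |(familyScore N w K q x T' / N : ℝ) - q * hitWeight w K T' / N| <
        (q * hitWeight w K O / N : ℝ) / 10) :
    4 * hitWeight w K O ≤ 5 * hitWeight w K T := by
  have hN' : (0 : ℝ) < N := by exact_mod_cast hN
  have hq' : (0 : ℝ) < q := by exact_mod_cast hq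
  have h1 := (abs_lt.mp (hdev T hT.1)).2
  have h2 := (abs_lt.mp (hdev O hO)).1
  have h3 : (familyScore N w K q x O / N : ℝ) ≤ familyScore N w K q x T / N := by
    gcongr
    exact hT.2 O hO
  have h4 : (q / N : ℝ) * (4 * hitWeight w K O) ≤ (q / N : ℝ) * (5 * hitWeight w K T) := by
    have e1 : (q * hitWeight w K O / N : ℝ) = (q / N : ℝ) * hitWeight w K O := by ring
    have e2 : (q * hitWeight w K T / N : ℝ) = (q / N : ℝ) * hitWeight w K T := by ring
    rw [e1] at h1 h2
    rw [e2] at h1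
    linarith
  exact_mod_cast le_of_mul_le_mul_left h4 (by positivity)

/-- There is a rate `q₀` at which about a quarter of the budget of edges is expected. -/
theorem exists_base_rate {N B W M : ℕ} (hWN : W < N) (hNW : N ≤ 2 * W)
    (hWM : W ≤ M) (hMB : 4 * M ≤ B * W) :
    ∃ q₀ : ℕ, 0 < q₀ ∧ q₀ ≤ B ∧ 4 * q₀ * M ≤ B * N ∧ B * N ≤ 8 * q₀ * M := by
  have hM : 0 < 4 * M := by omega
  have hle : 4 * M ≤ B * N := hMB.trans (Nat.mul_le_mul_left _ hWN.le)
  have hpos : 0 < B * N / (4 * M) := Nat.div_pos hle hM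
  have h1 := Nat.div_mul_le_self (B * N) (4 * M)
  have h2 := Nat.lt_div_mul_add hM (a := B * N)
  refine ⟨B * N / (4 * M), hpos, ?_, ?_, ?_⟩
  · apply Nat.div_le_of_le_mul
    calc B * N ≤ B * (4 * M) := Nat.mul_le_mul_left _ (by omega)
      _ = _ := by ring
  · calc _ = B * N / (4 * M) * (4 * M) := by ring
      _ ≤ _ := h1
  · have : 4 * M ≤ B * N / (4 * M) * (4 * M) := Nat.le_mul_of_pos_left _ hpos
    calc _ ≤ 2 * (B * N / (4 * M) * (4 * M)) := by omega
      _ = _ := by ring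

open Classical in
/-- With high probability, the best family in the sample is near-optimal. -/
theorem UniformIndep.card_bad_quality_le {N : ℕ} {u : Ω → ι → ℕ} (hu : UniformIndep N u)
    (hn : 3 ≤ n) {k : ℕ} (hk : 0 < k) (hkn : k ≤ n) (w : ι → ℕ) (K : ι → Finset (Fin n))
    (hK : ∀ v, 0 < #(K v)) (hKk : ∀ v, k * #(K v) ≤ 21 * n)
    (hWN : ∑ v, w v < N) (hNW : N ≤ 2 * ∑ v, w v) :
    (n : ℝ) * #{ω | ¬ ∀ T,
      IsBestFamily N w K k (sampleRate w (fun v => #(K v)) (edgeBudget n) (u ω)) (u ω) T →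
        ∀ O : Finset (Fin n), #O = k → 4 * hitWeight w K O ≤ 5 * hitWeight w K T} ≤
      Fintype.card Ω := by
  have hN : 0 < N := by omega
  have hN' : (0 : ℝ) < N := by exact_mod_cast hN
  have hn0 : 0 < n := by omega
  have hn' : (3 : ℝ) ≤ n := by exact_mod_cast hn
  set B := edgeBudget n with hB
  set l := Nat.size n with hl
  have hBl : B = 2000000 * n * l := rfl
  have hl2 : 2 ≤ l := Nat.lt_size.mpr (by omega)
  set M := ∑ v, w v * #(K v) with hM
  have hKn : ∀ v, #(K v) ≤ n := fun v => by simpa using card_le_univ (K v)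
  have hWM : ∑ v, w v ≤ M := sum_le_sum fun v _ => Nat.le_mul_of_pos_right _ (hK v)
  have hMW : M ≤ n * ∑ v, w v := by
    rw [hM, mul_sum]
    refine sum_le_sum fun v _ => ?_
    rw [mul_comm]
    exact Nat.mul_le_mul_right _ (hKn v)
  obtain ⟨q₀, hq₀, hq₀B, hq₀M, hMq₀⟩ := exists_base_rate (B := B) hWN hNW hWM (by
    calc 4 * M ≤ 4 * (n * ∑ v, w v) := Nat.mul_le_mul_left _ hMW
      _ = 4 * n * ∑ v, w v := by ring
      _ ≤ B * ∑ v, w v := Nat.mul_le_mul_right _ (by rw [hBl]; nlinarith))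
  -- an optimal family for the lists `K`
  obtain ⟨O, hOmem, hOmax⟩ := exists_max_image (powersetCard k (univ : Finset (Fin n)))
    (hitWeight w K) (powersetCard_nonempty.mpr (by simpa using hkn))
  have hO : #O = k := (mem_powersetCard.mp hOmem).2
  have hOmax' : ∀ T : Finset (Fin n), #T = k → hitWeight w K T ≤ hitWeight w K O := fun T hT =>
    hOmax T (mem_powersetCard.mpr ⟨subset_univ _, hT⟩)
  have hMO : k * M ≤ 22 * n * hitWeight w K O := by
    obtain ⟨T, hT, h⟩ := exists_hitWeight_ge_sum_degree hn0 w K hkn hKk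
    exact h.trans (Nat.mul_le_mul_left _ (hOmax' T hT))
  -- at every rate from `q₀` on, the expected estimate of the optimum is of order `k log n`
  have hμ : ∀ q : ℕ, q₀ ≤ q → (28 * (l * k) : ℝ) ≤ (q * hitWeight w K O / N : ℝ) / 400 := by
    intro q hq
    have hMpos : 0 < M := by omega
    have h1 : M * (28 * 400 * (l * k) * N) ≤ M * (q * hitWeight w K O) := by
      refine Nat.le_of_mul_le_mul_left (c := 176 * n) ?_ (by omega)
      calc 176 * n * (M * (28 * 400 * (l * k) * N))
          ≤ M * k * (B * N) := by rw [hBl]; nlinarith [Nat.zero_le (n * M * l * k * N)]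
        _ ≤ M * k * (8 * q₀ * M) := Nat.mul_le_mul_left _ hMq₀
        _ = 8 * q₀ * M * (k * M) := by ring
        _ ≤ 8 * q * M * (22 * n * hitWeight w K O) := by gcongr
        _ = _ := by ring
    have h2 : 28 * 400 * (l * k) * N ≤ q * hitWeight w K O := Nat.le_of_mul_le_mul_left h1 hMpos
    have h3 : (28 * 400 * (l * k) * N : ℝ) ≤ q * hitWeight w K O := by exact_mod_cast h2
    rw [div_div, le_div_iff₀ (by positivity)]
    linarith
  -- the two kinds of failure: the edges sampled at rate `q₀` exceed the budget, or the estimate of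
  -- some family deviates at some rate
  set E₂ : Finset Ω := {ω | (B : ℝ) ≤
    ((∑ v, if u ω v < q₀ * w v then #(K v) else 0 : ℕ) : ℝ)} with hE₂
  set E₃ : ℕ → Finset (Fin n) → Finset Ω := fun q T =>
    {ω | (q * hitWeight w K O / N : ℝ) / 10 ≤ |(familyScore N w K q (u ω) T / N : ℝ) -
      (∑ v, if ¬ Disjoint (K v) T then q * w v else 0 : ℕ) / N|} with hE₃
  have hsum : ∀ q T, (∑ v, if ¬ Disjoint (K v) T then q * w v else 0) = q * hitWeight w K T := by
    intro q T
    unfold hitWeight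
    rw [mul_sum]
    refine sum_congr rfl fun v _ => ?_
    by_cases h : Disjoint (K v) T <;> simp [h]
  have hsub : ({ω | ¬ ∀ T, IsBestFamily N w K k (sampleRate w (fun v => #(K v)) B (u ω)) (u ω) T →
        ∀ O : Finset (Fin n), #O = k → 4 * hitWeight w K O ≤ 5 * hitWeight w K T} : Finset Ω) ⊆
      E₂ ∪ (Icc q₀ B).biUnion fun q => (powersetCard k univ).biUnion (E₃ q) := by
    intro ω hω
    by_contra hcon
    refine (mem_filter.mp hω).2 fun T hT O' hO' => ?_
    simp only [mem_union, not_or, mem_biUnion, not_exists, not_and] at hcon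
    obtain ⟨hc2, hc3⟩ := hcon
    set q := sampleRate w (fun v => #(K v)) B (u ω) with hq
    have hqB : q ≤ B := Nat.findGreatest_le B
    have hq₀q : q₀ ≤ q := by
      refine Nat.le_findGreatest hq₀B ?_
      simp only [hE₂, mem_filter, mem_univ, true_and, not_le, Nat.cast_lt] at hc2
      exact hc2.le
    refine le_trans (Nat.mul_le_mul_left 4 (hOmax' O' hO')) ?_
    refine hT.four_mul_le hN (by omega) hO fun T' hT' => ?_
    have := hc3 q (mem_Icc.mpr ⟨hq₀q, hqB⟩) T' (mem_powersetCard.mpr ⟨subset_univ _, hT'⟩)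
    simp only [hE₃, mem_filter, mem_univ, true_and, not_le, hsum] at this
    push_cast at this
    exact this
  have hcΩ : (0 : ℝ) ≤ Fintype.card Ω := by positivity
  have hE₂c : (#E₂ : ℝ) ≤ Fintype.card Ω * (1 / (n * n)) := by
    refine (hu.card_sampled_size_ge_le hN (fun v => q₀ * w v) (fun v => #(K v)) hn0 hKn B).trans ?_
    refine mul_le_mul_of_nonneg_left ?_ hcΩ
    refine le_trans (Real.exp_le_exp.mpr ?_) (exp_neg_two_size_le hn0)
    have h1 : ∑ v, (#(K v) : ℝ) * ((q₀ * w v : ℕ) : ℝ) / N = q₀ * M / N := by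
      rw [hM]
      push_cast
      rw [mul_sum, sum_div]
      exact sum_congr rfl fun v _ => by ring
    rw [h1, div_le_iff₀ (by linarith)]
    have h2 : (q₀ * M / N : ℝ) ≤ B / 4 := by
      rw [div_le_iff₀ hN']
      have : (4 * q₀ * M : ℝ) ≤ B * N := by exact_mod_cast hq₀M
      linarith
    have h3 : (B : ℝ) = 2000000 * n * l := by rw [hBl]; push_cast; ring
    have h4 : (0 : ℝ) ≤ n * l := by positivity
    rw [h3] at h2 ⊢
    linarith
  have hE₃c : ∀ q ∈ Icc q₀ B, ∀ T ∈ powersetCard k (univ : Finset (Fin n)),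
      (#(E₃ q T) : ℝ) ≤ 2 * (Fintype.card Ω * Real.exp (-(28 * (l * k)))) := by
    intro q hq T hT
    refine (hu.card_score_deviation_le hN (fun v => q * w v) (fun v => ¬ Disjoint (K v) T)
      (μ := (q * hitWeight w K O / N : ℝ)) ?_).trans ?_
    · rw [hsum]
      push_cast
      gcongr
      exact hOmax T hT
    · have := hμ q (mem_Icc.mp hq).1
      gcongr
  have hunion : (#((Icc q₀ B).biUnion fun q => (powersetCard k univ).biUnion (E₃ q)) : ℝ) ≤
      B * (n ^ k * (2 * (Fintype.card Ω * Real.exp (-(28 * (l * k)))))) := by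
    have h0 : (0 : ℝ) ≤ 2 * (Fintype.card Ω * Real.exp (-(28 * (l * k)))) := by positivity
    have h1 : (#((Icc q₀ B).biUnion fun q => (powersetCard k univ).biUnion (E₃ q)) : ℝ) ≤
        ∑ q ∈ Icc q₀ B, ∑ T ∈ powersetCard k (univ : Finset (Fin n)), (#(E₃ q T) : ℝ) := by
      have : #((Icc q₀ B).biUnion fun q => (powersetCard k univ).biUnion (E₃ q)) ≤
          ∑ q ∈ Icc q₀ B, ∑ T ∈ powersetCard k (univ : Finset (Fin n)), #(E₃ q T) :=
        card_biUnion_le.trans (sum_le_sum fun q _ => card_biUnion_le)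
      exact_mod_cast this
    refine h1.trans ((sum_le_sum fun q hq => sum_le_sum fun T hT => hE₃c q hq T hT).trans ?_)
    rw [sum_const, sum_const, nsmul_eq_mul, nsmul_eq_mul, card_powersetCard, Nat.card_Icc,
      card_univ, Fintype.card_fin]
    gcongr
    · omega
    · exact_mod_cast Nat.choose_le_pow n k
  -- `n` and `l` are at most `exp l`, and `4000000 ≤ exp (12 * l)` since `l ≥ 2`
  have hsmall : (B : ℝ) * (n ^ k * (2 * Real.exp (-(28 * (l * k))))) ≤ 1 / (n * n) := by
    refine le_trans ?_ (exp_neg_two_size_le hn0)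
    have hnexp := cast_le_exp_size n
    rw [← hl] at hnexp ⊢
    have h1 : (n : ℝ) ^ k ≤ Real.exp (l * k) := by
      calc (n : ℝ) ^ k ≤ Real.exp l ^ k := by gcongr
        _ = _ := by rw [← Real.exp_nat_mul, mul_comm]
    have h2 : (4000000 : ℝ) ≤ Real.exp (12 * l) := by
      have h3 : Real.exp 24 ≤ Real.exp (12 * l) := by
        apply Real.exp_le_exp.mpr
        have : (2 : ℝ) ≤ l := by exact_mod_cast hl2
        linarith
      have h4 : (2 : ℝ) ^ 24 ≤ Real.exp 24 := by
        have : Real.exp 24 = Real.exp 1 ^ 24 := by rw [← Real.exp_nat_mul]; norm_num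
        rw [this]
        gcongr
        linarith [Real.exp_one_gt_d9]
      norm_num at h4
      linarith
    have h3 : (B : ℝ) * 2 ≤ Real.exp (12 * l) * Real.exp l * Real.exp l := by
      rw [hBl]
      push_cast
      calc (2000000 * n * l * 2 : ℝ) = 4000000 * n * l := by ring
        _ ≤ _ := by
          gcongr
          exact cast_le_exp l
    calc (B : ℝ) * (n ^ k * (2 * Real.exp (-(28 * (l * k)))))
        = B * 2 * (n ^ k * Real.exp (-(28 * (l * k)))) := by ring
      _ ≤ (Real.exp (12 * l) * Real.exp l * Real.exp l) *
          (Real.exp (l * k) * Real.exp (-(28 * (l * k)))) := by gcongr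
      _ = Real.exp (12 * l + l + l + (l * k + -(28 * (l * k)))) := by simp only [Real.exp_add]
      _ ≤ _ := by
        apply Real.exp_le_exp.mpr
        have h5 : (1 : ℝ) ≤ k := by exact_mod_cast hk
        have h6 : (0 : ℝ) ≤ l := by positivity
        nlinarith
  have htotal : (#{ω | ¬ ∀ T,
      IsBestFamily N w K k (sampleRate w (fun v => #(K v)) B (u ω)) (u ω) T →
        ∀ O : Finset (Fin n), #O = k → 4 * hitWeight w K O ≤ 5 * hitWeight w K T} : ℝ) ≤
      Fintype.card Ω * (2 / (n * n)) := by
    have h1 : (#{ω | ¬ ∀ T, IsBestFamily N w K k (sampleRate w (fun v => #(K v)) B (u ω)) (u ω) T →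
        ∀ O : Finset (Fin n), #O = k → 4 * hitWeight w K O ≤ 5 * hitWeight w K T} : ℝ) ≤
        #E₂ + #((Icc q₀ B).biUnion fun q => (powersetCard k univ).biUnion (E₃ q)) := by
      exact_mod_cast (card_le_card hsub).trans (card_union_le _ _)
    have h2 := mul_le_mul_of_nonneg_left hsmall hcΩ
    have h3 : (Fintype.card Ω : ℝ) * (2 / (n * n)) =
      Fintype.card Ω * (1 / (n * n)) + Fintype.card Ω * (1 / (n * n)) := by ring
    rw [h3]
    linarith
  calc (n : ℝ) * _ ≤ n * (Fintype.card Ω * (2 / (n * n))) :=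
        mul_le_mul_of_nonneg_left htotal (by positivity)
    _ = Fintype.card Ω * (2 / n) := by field_simp
    _ ≤ Fintype.card Ω * 1 := by
        gcongr
        rw [div_le_one (by linarith)]
        linarith
    _ = _ := mul_one _

end Quality

/-! ### The distributed algorithm -/

namespace KCover

open MapReduce

/-- The weight of the element whose records are `msgs`. Edge records start with `0` and the weight
record with `1`, so only the latter contributes. -/
def weightOf (msgs : List Data) : ℕ := (msgs.map fun d => d.headI * d.getI 2).sum

/-- The sets that contain the element whose records are `msgs`. -/
def edgesOf (msgs : List Data) : List ℕ := (msgs.filter fun d => d.headI = 0).map fun d => d.getI 2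

/-- The number whose binary digits, least significant first, are `c`. -/
def coinNumber (c : List Bool) : ℕ := c.foldr (fun b x => b.toNat + 2 * x) 0

/-- The largest number of sets that an element remembers. The value `1` for `k = 0` plays no
role. -/
def degreeCap (n k : ℕ) : ℕ := 20 * n / k + 1

/-- What an element keeps in its memory: its weight, followed by at most `degreeCap n k` of the
sets that contain it. -/
def digest (n k : ℕ) (msgs : List Data) : Data :=
  weightOf msgs :: (edgesOf msgs).take (degreeCap n k)

/-- Round `0`: every element draws a number `u` and offers itself to machine `0` if it is sampled at
the largest rate, `u < B * weight`. The offer consists of address, weight, degree and `u`. -/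
def offerStep (pub : List ℕ) (i : ℕ) (c : List Bool) (msgs : List Data) : Data × List Letter :=
  (digest (pub.getI 0) (pub.getI 2) msgs,
    if coinNumber c < edgeBudget (pub.getI 0) * weightOf msgs then
      [(0, [i, weightOf msgs, (digest (pub.getI 0) (pub.getI 2) msgs).tail.length, coinNumber c])]
    else [])

/-- The number of edges offered at rate `q`. -/
def offeredEdges (msgs : List Data) (q : ℕ) : ℕ :=
  (msgs.map fun d => if d.getI 3 < q * d.getI 1 then d.getI 2 else 0).sum

/-- The largest rate at which the offered edges fit into the budget. -/
def chosenRate (n : ℕ) (msgs : List Data) : ℕ :=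
  Nat.findGreatest (fun q => offeredEdges msgs q ≤ edgeBudget n) (edgeBudget n)

/-- Round `1`: machine `0` asks the elements sampled at the chosen rate for their sets. -/
def requestStep (pub : List ℕ) (mem : Data) (msgs : List Data) : Data × List Letter :=
  (mem, (msgs.filter fun d => d.getI 3 < chosenRate (pub.getI 0) msgs * d.getI 1).map
    fun d => (d.getI 0, [chosenRate (pub.getI 0) msgs]))

/-- Round `2`: elements that were asked at rate `q` send the value with which they count in the
estimate, followed by their sets. -/
def replyStep (pub : List ℕ) (mem : Data) (msgs : List Data) : Data × List Letter :=
  ([], msgs.map fun d =>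
    (0, max (2 ^ Nat.size (pub.getI 4)) (d.headI * mem.headI) :: mem.tail))

/-- The estimate, up to the sampling rate as a factor, of the weight covered by the family listed in
`l`. Each message is the value of an element followed by its sets. -/
def listScore (msgs : List Data) (l : List ℕ) : ℕ :=
  (msgs.map fun d => if ∃ x ∈ d.tail, x ∈ l then d.headI else 0).sum

/-- The better one of two families. -/
def better (msgs : List Data) (l l' : List ℕ) : List ℕ :=
  if listScore msgs l < listScore msgs l' then l' else l

/-- All families of `k` out of `n` sets. -/
def choices (n k : ℕ) : List (List ℕ) := (List.range n).sublists'.filter fun l => l.length = k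

/-- A best family of `k` out of `n` sets, found by exhaustive search. -/
def bestChoice (n k : ℕ) (msgs : List Data) : List ℕ :=
  (choices n k).foldl (better msgs) (List.range k)

/-- The local computation of one round. -/
def step (V : View) : Data × List Letter :=
  match V with
  | (pub, r, i, c, mem, msgs) =>
    if r = 0 then offerStep pub i c msgs
    else if r = 1 then requestStep pub mem msgs
    else if r = 2 then replyStep pub mem msgs
    else (bestChoice (pub.getI 0) (pub.getI 2) msgs, [])

/-! ### Computability of the algorithm -/

theorem primrec_list_sum : Primrec (List.sum : List ℕ → ℕ) := by
  refine (Primrec.list_foldr (f := fun l : List ℕ => l) (g := fun _ => 0)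
    (h := fun _ p => p.1 + p.2) Primrec.id (Primrec.const 0) ?_).of_eq fun l => ?_
  · exact Primrec.nat_add.comp (Primrec.fst.comp Primrec.snd) (Primrec.snd.comp Primrec.snd)
  · rfl

theorem primrec_getI (j : ℕ) : Primrec fun l : List ℕ => l.getI j :=
  Primrec.list_getI.comp Primrec.id (Primrec.const j)

theorem primrec_two_pow : Primrec fun a : ℕ => 2 ^ a := by
  refine (Primrec.nat_rec₁ (f := fun _ x => 2 * x) 1
    (Primrec.nat_double.comp Primrec.snd)).of_eq fun a => ?_
  induction a with
  | zero => rfl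
  | succ a ih => rw [pow_succ, ← ih]; exact mul_comm _ _

theorem primrec_size : Primrec Nat.size := by
  have hp : PrimrecRel fun x a : ℕ => a = 0 ∨ 2 ^ (a - 1) ≤ x := by
    refine PrimrecPred.or ?_ ?_
    · exact Primrec.eq.comp Primrec.snd (Primrec.const 0)
    · exact Primrec.nat_le.comp (primrec_two_pow.comp (Primrec.pred.comp Primrec.snd)) Primrec.fst
  refine (Primrec.nat_findGreatest (f := fun x : ℕ => x) Primrec.id hp).of_eq fun x => ?_
  rw [Nat.findGreatest_eq_iff]
  refine ⟨Nat.size_le.mpr Nat.lt_two_pow_self, fun h => Or.inr ?_, fun a ha _ h => ?_⟩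
  · exact Nat.lt_size.mp (by omega)
  · rcases h with h | h
    · omega
    · have := Nat.lt_size.mpr h
      omega

theorem primrec_sublists' : Primrec (List.sublists' : List ℕ → List (List ℕ)) := by
  refine (Primrec.list_foldr (f := fun l : List ℕ => l) (g := fun _ => [[]])
    (h := fun _ p => p.2 ++ p.2.map (List.cons p.1)) Primrec.id (Primrec.const [[]]) ?_).of_eq
    fun l => ?_
  · refine Primrec.list_append.comp (Primrec.snd.comp Primrec.snd)
      (Primrec.list_map (Primrec.snd.comp Primrec.snd) ?_)
    exact Primrec.list_cons.comp (Primrec.fst.comp (Primrec.snd.comp Primrec.fst)) Primrec.snd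
  · induction l with
    | nil => rfl
    | cons a l ih => rw [List.sublists'_cons, ← ih]; rfl

theorem primrec_edgeBudget : Primrec edgeBudget :=
  Primrec.nat_mul.comp (Primrec.nat_mul.comp (Primrec.const _) Primrec.id) primrec_size

theorem primrec_weightOf : Primrec weightOf :=
  primrec_list_sum.comp (Primrec.list_map Primrec.id
    (Primrec.nat_mul.comp (Primrec.list_headI.comp Primrec.snd)
      ((primrec_getI 2).comp Primrec.snd)))

theorem primrec_edgesOf : Primrec edgesOf := by
  refine Primrec.list_map (Primrec.listFilter ?_) ((primrec_getI 2).comp Primrec.snd)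
  exact Primrec.eq.comp Primrec.list_headI (Primrec.const 0)

theorem primrec_coinNumber : Primrec coinNumber := by
  refine Primrec.list_foldr (h := fun _ p => Bool.toNat p.1 + 2 * p.2) Primrec.id
    (Primrec.const 0) ?_
  exact Primrec.nat_add.comp ((Primrec.dom_bool Bool.toNat).comp (Primrec.fst.comp Primrec.snd))
    (Primrec.nat_double.comp (Primrec.snd.comp Primrec.snd))

section

variable {α : Type*} [Primcodable α]

theorem primrec_digest {n k : α → ℕ} {msgs : α → List Data} (hn : Primrec n) (hk : Primrec k)
    (hm : Primrec msgs) : Primrec fun x => digest (n x) (k x) (msgs x) := by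
  refine Primrec.list_cons.comp (primrec_weightOf.comp hm)
    (Primrec.list_take.comp ?_ (primrec_edgesOf.comp hm))
  exact Primrec.succ.comp
    (Primrec.nat_div.comp (Primrec.nat_mul.comp (Primrec.const 20) hn) hk)

theorem primrec_offerStep {pub : α → List ℕ} {i : α → ℕ} {c : α → List Bool}
    {msgs : α → List Data} (hpub : Primrec pub) (hi : Primrec i) (hc : Primrec c)
    (hm : Primrec msgs) : Primrec fun x => offerStep (pub x) (i x) (c x) (msgs x) := by
  have hn := (primrec_getI 0).comp hpub
  have hw := primrec_weightOf.comp hm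
  have hd := primrec_digest hn ((primrec_getI 2).comp hpub) hm
  have hu := primrec_coinNumber.comp hc
  refine Primrec.pair hd (Primrec.ite (Primrec.nat_lt.comp hu
    (Primrec.nat_mul.comp (primrec_edgeBudget.comp hn) hw)) ?_ (Primrec.const []))
  refine Primrec.list_cons.comp (Primrec.pair (Primrec.const 0) ?_) (Primrec.const [])
  exact Primrec.list_cons.comp hi (Primrec.list_cons.comp hw (Primrec.list_cons.comp
    (Primrec.list_length.comp (Primrec.list_tail.comp hd))
    (Primrec.list_cons.comp hu (Primrec.const []))))

theorem primrecRel_sampled : PrimrecRel fun (d : Data) (q : ℕ) => d.getI 3 < q * d.getI 1 :=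
  Primrec.nat_lt.comp ((primrec_getI 3).comp Primrec.fst)
    (Primrec.nat_mul.comp Primrec.snd ((primrec_getI 1).comp Primrec.fst))

theorem primrec_offeredEdges : Primrec₂ offeredEdges := by
  refine primrec_list_sum.comp (Primrec.list_map Primrec.fst ?_)
  refine Primrec.ite ?_ ((primrec_getI 2).comp Primrec.snd) (Primrec.const 0)
  exact primrecRel_sampled.comp Primrec.snd (Primrec.snd.comp Primrec.fst)

theorem primrec_chosenRate : Primrec₂ chosenRate := by
  refine Primrec.nat_findGreatest (α := ℕ × List Data)
    (p := fun x q => offeredEdges x.2 q ≤ edgeBudget x.1)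
    (primrec_edgeBudget.comp Primrec.fst) ?_
  exact Primrec.nat_le.comp
    (primrec_offeredEdges.comp (Primrec.snd.comp Primrec.fst) Primrec.snd)
    (primrec_edgeBudget.comp (Primrec.fst.comp Primrec.fst))

theorem primrec_requestStep {pub : α → List ℕ} {mem : α → Data} {msgs : α → List Data}
    (hpub : Primrec pub) (hmem : Primrec mem) (hm : Primrec msgs) :
    Primrec fun x => requestStep (pub x) (mem x) (msgs x) := by
  have hq := primrec_chosenRate.comp ((primrec_getI 0).comp hpub) hm
  refine Primrec.pair hmem (Primrec.list_map (primrecRel_sampled.listFilter.comp hm hq) ?_)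
  exact Primrec.pair ((primrec_getI 0).comp Primrec.snd)
    (Primrec.list_cons.comp (hq.comp Primrec.fst) (Primrec.const []))

theorem primrec_replyStep {pub : α → List ℕ} {mem : α → Data} {msgs : α → List Data}
    (hpub : Primrec pub) (hmem : Primrec mem) (hm : Primrec msgs) :
    Primrec fun x => replyStep (pub x) (mem x) (msgs x) := by
  refine Primrec.pair (Primrec.const []) (Primrec.list_map hm ?_)
  refine Primrec.pair (Primrec.const 0) (Primrec.list_cons.comp ?_
    (Primrec.list_tail.comp (hmem.comp Primrec.fst)))
  exact Primrec.nat_max.comp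
    (primrec_two_pow.comp (primrec_size.comp (((primrec_getI 4).comp hpub).comp Primrec.fst)))
    (Primrec.nat_mul.comp (Primrec.list_headI.comp Primrec.snd)
      (Primrec.list_headI.comp (hmem.comp Primrec.fst)))

theorem primrecRel_mem : PrimrecRel fun (x : ℕ) (l : List ℕ) => x ∈ l := by
  have h : PrimrecRel fun (x : ℕ) (l : List ℕ) => ∃ y ∈ l, y = x :=
    (PrimrecRel.exists_mem_list Primrec.eq).swap
  exact h.of_eq fun x l => by simp

theorem primrec_listScore : Primrec₂ listScore := by
  refine primrec_list_sum.comp (Primrec.list_map Primrec.fst ?_)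
  refine Primrec.ite ?_ (Primrec.list_headI.comp Primrec.snd) (Primrec.const 0)
  exact (PrimrecRel.exists_mem_list primrecRel_mem).comp (Primrec.list_tail.comp Primrec.snd)
    (Primrec.snd.comp Primrec.fst)

theorem primrec_bestChoice {n k : α → ℕ} {msgs : α → List Data} (hn : Primrec n) (hk : Primrec k)
    (hm : Primrec msgs) : Primrec fun x => bestChoice (n x) (k x) (msgs x) := by
  refine Primrec.list_foldl (f := fun x => choices (n x) (k x)) (g := fun x => List.range (k x))
    (h := fun x p => better (msgs x) p.1 p.2) ?_ (Primrec.list_range.comp hk) ?_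
  · have hR : PrimrecRel fun (l : List ℕ) (k : ℕ) => l.length = k :=
      Primrec.eq.comp (Primrec.list_length.comp Primrec.fst) Primrec.snd
    exact hR.listFilter.comp (primrec_sublists'.comp (Primrec.list_range.comp hn)) hk
  · have h1 : Primrec fun p : α × List ℕ × List ℕ => p.2.1 := Primrec.fst.comp Primrec.snd
    have h2 : Primrec fun p : α × List ℕ × List ℕ => p.2.2 := Primrec.snd.comp Primrec.snd
    have h3 : Primrec fun p : α × List ℕ × List ℕ => msgs p.1 := hm.comp Primrec.fst
    exact Primrec.ite (Primrec.nat_lt.comp (primrec_listScore.comp h3 h1)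
      (primrec_listScore.comp h3 h2)) h2 h1

end

theorem primrec_step : Primrec step := by
  have hpub : Primrec fun V : View => V.1 := Primrec.fst
  have hr : Primrec fun V : View => V.2.1 := Primrec.fst.comp Primrec.snd
  have h3 : Primrec fun V : View => V.2.2 := Primrec.snd.comp Primrec.snd
  have hi : Primrec fun V : View => V.2.2.1 := Primrec.fst.comp h3
  have h4 : Primrec fun V : View => V.2.2.2 := Primrec.snd.comp h3
  have hc : Primrec fun V : View => V.2.2.2.1 := Primrec.fst.comp h4
  have h5 : Primrec fun V : View => V.2.2.2.2 := Primrec.snd.comp h4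
  have hmem : Primrec fun V : View => V.2.2.2.2.1 := Primrec.fst.comp h5
  have hm : Primrec fun V : View => V.2.2.2.2.2 := Primrec.snd.comp h5
  have hround : ∀ r : ℕ, PrimrecPred fun V : View => V.2.1 = r := fun r =>
    Primrec.eq.comp hr (Primrec.const r)
  exact Primrec.ite (hround 0) (primrec_offerStep hpub hi hc hm)
    (Primrec.ite (hround 1) (primrec_requestStep hpub hmem hm)
      (Primrec.ite (hround 2) (primrec_replyStep hpub hmem hm)
        (Primrec.pair (primrec_bestChoice ((primrec_getI 0).comp hpub) ((primrec_getI 2).comp hpub)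
          hm) (Primrec.const []))))

/-- The four-round algorithm. The records of element `v` go to machine `v + 1`, and every machine
flips as many coins as the total weight has binary digits. -/
def algorithm : Algorithm where
  coins pub := Nat.size (pub.getI 4)
  route x := x.2.getI 1 + 1
  step := step
  coins_computable := (primrec_size.comp (primrec_getI 4)).to_comp
  route_computable := (Primrec.succ.comp ((primrec_getI 1).comp Primrec.snd)).to_comp
  step_computable := primrec_step.to_comp

end KCover

/-! ### What the machines hold at the start -/

namespace KCover

open MapReduce

variable {n m : ℕ}

/-- The records delivered to machine `j`. -/
def recordsAt (input : List Data) (j : ℕ) : List Data := input.filter fun d => d.getI 1 + 1 = j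

/-- The sets containing an element. -/
def memberSets (I : WeightedCover n m) (v : Fin m) : Finset (Fin n) := {S | v ∈ I.sets S}

/-- The list of sets that element `v` keeps. -/
def keptList (k : ℕ) (n : ℕ) (input : List Data) (v : Fin m) : List ℕ :=
  (edgesOf (recordsAt input (v + 1))).take (degreeCap n k)

/-- The family of sets that element `v` keeps. -/
def keptSets (n k : ℕ) (input : List Data) (v : Fin m) : Finset (Fin n) :=
  {S | (S : ℕ) ∈ keptList k n input v}

variable {I : WeightedCover n m} {input : List Data}

theorem recordsAt_zero : recordsAt input 0 = [] := by simp [recordsAt]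

theorem mem_recordsAt (h : I.IsInput input) {v : Fin m} {d : Data} :
    d ∈ recordsAt input (v + 1) ↔
      (∃ S : Fin n, v ∈ I.sets S ∧ d = [0, (v : ℕ), (S : ℕ)]) ∨ d = [1, (v : ℕ), I.weight v] := by
  simp only [recordsAt, List.mem_filter, h.2 d, decide_eq_true_eq]
  constructor
  · rintro ⟨⟨S, v', hv', rfl⟩ | ⟨v', rfl⟩, h2⟩
    · have : v' = v := Fin.ext (by simpa [List.getI] using h2)
      subst this
      exact Or.inl ⟨S, hv', rfl⟩
    · have : v' = v := Fin.ext (by simpa [List.getI] using h2)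
      subst this
      exact Or.inr rfl
  · rintro (⟨S, hS, rfl⟩ | rfl)
    · exact ⟨Or.inl ⟨S, v, hS, rfl⟩, by simp [List.getI]⟩
    · exact ⟨Or.inr ⟨v, rfl⟩, by simp [List.getI]⟩

theorem nodup_recordsAt (h : I.IsInput input) (j : ℕ) : (recordsAt input j).Nodup :=
  h.1.filter _

theorem weightOf_recordsAt (h : I.IsInput input) (v : Fin m) :
    weightOf (recordsAt input (v + 1)) = I.weight v := by
  rw [weightOf, ← List.sum_toFinset _ (nodup_recordsAt h _),
    sum_eq_single [1, (v : ℕ), I.weight v]]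
  · simp [List.getI]
  · intro d hd hne
    rcases (mem_recordsAt h).mp (List.mem_toFinset.mp hd) with ⟨S, -, rfl⟩ | rfl
    · simp
    · exact absurd rfl hne
  · intro hd
    exact absurd (List.mem_toFinset.mpr ((mem_recordsAt h).mpr (Or.inr rfl))) hd

theorem mem_edgesOf_recordsAt (h : I.IsInput input) {v : Fin m} {x : ℕ} :
    x ∈ edgesOf (recordsAt input (v + 1)) ↔ ∃ S ∈ memberSets I v, (S : ℕ) = x := by
  simp only [edgesOf, List.mem_map, List.mem_filter, mem_recordsAt h, decide_eq_true_eq,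
    memberSets, mem_filter, mem_univ, true_and]
  constructor
  · rintro ⟨d, ⟨⟨S, hS, rfl⟩ | rfl, hd⟩, rfl⟩
    · exact ⟨S, hS, by simp [List.getI]⟩
    · simp at hd
  · rintro ⟨S, hS, rfl⟩
    exact ⟨[0, (v : ℕ), (S : ℕ)], ⟨Or.inl ⟨S, hS, rfl⟩, by simp⟩, by simp [List.getI]⟩

theorem nodup_edgesOf_recordsAt (h : I.IsInput input) (v : Fin m) :
    (edgesOf (recordsAt input (v + 1))).Nodup := by
  refine List.Nodup.map_on ?_ ((nodup_recordsAt h _).filter _)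
  intro d hd d' hd' heq
  simp only [List.mem_filter, mem_recordsAt h, decide_eq_true_eq] at hd hd'
  obtain ⟨⟨S, -, rfl⟩ | rfl, h1⟩ := hd <;> obtain ⟨⟨S', -, rfl⟩ | rfl, h2⟩ := hd'
  · simpa [List.getI] using heq
  · simp at h2
  · simp at h1
  · rfl

theorem length_edgesOf_recordsAt (h : I.IsInput input) (v : Fin m) :
    (edgesOf (recordsAt input (v + 1))).length = #(memberSets I v) := by
  rw [← List.toFinset_card_of_nodup (nodup_edgesOf_recordsAt h v),
    ← card_map (Fin.valEmbedding)]
  congr 1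
  ext x
  simp [mem_edgesOf_recordsAt h]

theorem mem_keptList_lt (h : I.IsInput input) {k : ℕ} {v : Fin m} {x : ℕ}
    (hx : x ∈ keptList k n input v) : ∃ S ∈ keptSets n k input v, (S : ℕ) = x := by
  obtain ⟨S, -, rfl⟩ := (mem_edgesOf_recordsAt h).mp (List.mem_of_mem_take hx)
  exact ⟨S, by simpa [keptSets] using hx, rfl⟩

theorem length_keptList (h : I.IsInput input) (k : ℕ) (v : Fin m) :
    (keptList k n input v).length = #(keptSets n k input v) := by
  have hnd : (keptList k n input v).Nodup :=
    (nodup_edgesOf_recordsAt h v).sublist (List.take_sublist _ _)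
  rw [← List.toFinset_card_of_nodup hnd, ← card_map (Fin.valEmbedding)]
  congr 1
  ext x
  simp only [List.mem_toFinset, mem_map, Fin.valEmbedding_apply]
  refine ⟨mem_keptList_lt h, ?_⟩
  rintro ⟨S, hS, rfl⟩
  simpa [keptSets] using hS

theorem keptSets_subset (h : I.IsInput input) (k : ℕ) (v : Fin m) :
    keptSets n k input v ⊆ memberSets I v := by
  intro S hS
  simp only [keptSets, mem_filter, mem_univ, true_and] at hS
  obtain ⟨S', hS', heq⟩ := (mem_edgesOf_recordsAt h).mp (List.mem_of_mem_take hS)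
  rwa [← Fin.ext heq]

theorem card_keptSets (h : I.IsInput input) (k : ℕ) (v : Fin m) :
    #(keptSets n k input v) = min (degreeCap n k) #(memberSets I v) := by
  rw [← length_keptList h, keptList, List.length_take, length_edgesOf_recordsAt h]

theorem digest_recordsAt (h : I.IsInput input) (k : ℕ) (v : Fin m) :
    digest n k (recordsAt input (v + 1)) = I.weight v :: keptList k n input v := by
  rw [digest, weightOf_recordsAt h]; rfl

theorem coverage_eq_hitWeight (I : WeightedCover n m) (T : Finset (Fin n)) :
    I.coverage T = hitWeight I.weight (memberSets I) T := by
  have h : ∀ v, (if Disjoint (memberSets I v) T then 0 else I.weight v) =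
      if ¬ Disjoint (memberSets I v) T then I.weight v else 0 := fun v => (ite_not _ _ _).symm
  rw [WeightedCover.coverage, hitWeight, sum_congr rfl fun v _ => h v, ← sum_filter]
  refine sum_congr ?_ fun _ _ => rfl
  ext v
  simp only [mem_biUnion, mem_filter, mem_univ, true_and, not_disjoint_iff, memberSets]
  exact ⟨fun ⟨S, h1, h2⟩ => ⟨S, h2, h1⟩, fun ⟨S, h1, h2⟩ => ⟨S, h2, h1⟩⟩

/-! ### Exhaustive search -/

theorem listScore_le_foldl_better (msgs : List Data) (L : List (List ℕ)) (l₀ : List ℕ) :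
    listScore msgs l₀ ≤ listScore msgs (L.foldl (better msgs) l₀) ∧
      ∀ l ∈ L, listScore msgs l ≤ listScore msgs (L.foldl (better msgs) l₀) := by
  induction L generalizing l₀ with
  | nil => simp
  | cons a L ih =>
    have h1 : listScore msgs l₀ ≤ listScore msgs (better msgs l₀ a) := by
      unfold better; split_ifs <;> omega
    have h2 : listScore msgs a ≤ listScore msgs (better msgs l₀ a) := by
      unfold better; split_ifs <;> omega
    obtain ⟨h3, h4⟩ := ih (better msgs l₀ a)
    refine ⟨h1.trans h3, fun l hl => ?_⟩
    rcases List.mem_cons.mp hl with rfl | hl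
    · exact h2.trans h3
    · exact h4 l hl

theorem foldl_better_mem (msgs : List Data) (L : List (List ℕ)) (l₀ : List ℕ) :
    L.foldl (better msgs) l₀ ∈ l₀ :: L := by
  induction L generalizing l₀ with
  | nil => simp
  | cons a L ih =>
    have := ih (better msgs l₀ a)
    have h2 : better msgs l₀ a = l₀ ∨ better msgs l₀ a = a := by
      unfold better; split_ifs <;> simp
    simp only [List.foldl_cons, List.mem_cons] at this ⊢
    rcases this with h | h
    · rcases h2 with h2 | h2 <;> rw [h, h2] <;> simp
    · simp [h]

theorem mem_choices {n k : ℕ} {l : List ℕ} :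
    l ∈ choices n k ↔ l.Sublist (List.range n) ∧ l.length = k := by
  simp [choices, List.mem_sublists']

theorem bestChoice_mem {n k : ℕ} (hk : k ≤ n) (msgs : List Data) :
    bestChoice n k msgs ∈ choices n k := by
  rcases List.mem_cons.mp (foldl_better_mem msgs (choices n k) (List.range k)) with h | h
  · rw [bestChoice, h, mem_choices]
    exact ⟨List.range_sublist.mpr hk, List.length_range⟩
  · exact h

theorem exists_family_of_mem_choices {n k : ℕ} {l : List ℕ} (hl : l ∈ choices n k) :
    ∃ T : Finset (Fin n), #T = k ∧ l.toFinset = T.map Fin.valEmbedding := by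
  obtain ⟨h1, h2⟩ := mem_choices.mp hl
  have hset : l.toFinset = ({S | (S : ℕ) ∈ l} : Finset (Fin n)).map Fin.valEmbedding := by
    ext x
    simp only [List.mem_toFinset, mem_map, mem_filter, mem_univ, true_and, Fin.valEmbedding_apply]
    exact ⟨fun hx => ⟨⟨x, List.mem_range.mp (h1.subset hx)⟩, hx, rfl⟩,
      fun ⟨S, hS, h⟩ => h ▸ hS⟩
  refine ⟨_, ?_, hset⟩
  rw [← card_map Fin.valEmbedding, ← hset,
    List.toFinset_card_of_nodup (List.nodup_range.sublist h1), h2]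

theorem exists_mem_choices {n k : ℕ} {T : Finset (Fin n)} (hT : #T = k) :
    ∃ l ∈ choices n k, l.toFinset = T.map Fin.valEmbedding := by
  have hset : ((List.range n).filter (· ∈ T.map Fin.valEmbedding)).toFinset =
      T.map Fin.valEmbedding := by
    ext x
    simp only [List.mem_toFinset, List.mem_filter, List.mem_range, decide_eq_true_eq,
      and_iff_right_iff_imp, mem_map, Fin.valEmbedding_apply]
    rintro ⟨S, -, rfl⟩
    exact S.2
  refine ⟨_, mem_choices.mpr ⟨List.filter_sublist, ?_⟩, hset⟩
  rw [← List.toFinset_card_of_nodup (List.nodup_range.filter _), hset, card_map, hT]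

/-! ### The run of the algorithm -/

/-- The letters `f v` of the elements `v` with `p v`, in the order of the elements. -/
def lettersOf (p : Fin m → Prop) [DecidablePred p] (f : Fin m → Data) : List Data :=
  (List.finRange m).flatMap fun v => if p v then [f v] else []

theorem sum_map_lettersOf (p : Fin m → Prop) [DecidablePred p] (f : Fin m → Data) (g : Data → ℕ) :
    ((lettersOf p f).map g).sum = ∑ v, if p v then g (f v) else 0 := by
  rw [Fin.sum_univ_def, lettersOf]
  induction List.finRange m with
  | nil => rfl
  | cons a l ih =>
    rw [List.flatMap_cons, List.map_append, List.sum_append, ih, List.map_cons, List.sum_cons]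
    split_ifs <;> simp

theorem findGreatest_congr {P Q : ℕ → Prop} [DecidablePred P] [DecidablePred Q] {b : ℕ}
    (h : ∀ i ≤ b, P i ↔ Q i) : Nat.findGreatest P b = Nat.findGreatest Q b := by
  induction b with
  | zero => rfl
  | succ b ih =>
    rw [Nat.findGreatest_succ, Nat.findGreatest_succ, ih fun i hi => h i (by omega)]
    simp only [h (b + 1) le_rfl]

/-- The random number drawn by element `v` in the first round. -/
def drawn {p l R : ℕ} (ω : Fin (R + 1) → RoundCoins (p + 1) l) (v : Fin p) : ℕ :=
  coinNumber (List.ofFn (ω 0 v.succ))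

/-- The offers received by machine `0`. -/
def offers (I : WeightedCover n m) (k : ℕ) (input : List Data) (x : Fin m → ℕ) : List Data :=
  lettersOf (fun v => x v < edgeBudget n * I.weight v)
    fun v => [(v : ℕ) + 1, I.weight v, #(keptSets n k input v), x v]

/-- The rate chosen by machine `0`. -/
def rate (I : WeightedCover n m) (k : ℕ) (input : List Data) (x : Fin m → ℕ) : ℕ :=
  sampleRate I.weight (fun v => #(keptSets n k input v)) (edgeBudget n) x

/-- The replies received by machine `0`. -/
def replies (I : WeightedCover n m) (k : ℕ) (input : List Data) (x : Fin m → ℕ) : List Data :=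
  lettersOf (fun v => x v < rate I k input x * I.weight v)
    fun v =>
      max (2 ^ Nat.size I.totalWeight) (rate I k input x * I.weight v) :: keptList k n input v

theorem rate_le (I : WeightedCover n m) (k : ℕ) (input : List Data) (x : Fin m → ℕ) :
    rate I k input x ≤ edgeBudget n := Nat.findGreatest_le _

theorem sampledEdges_rate_le (I : WeightedCover n m) (k : ℕ) (input : List Data) (x : Fin m → ℕ) :
    sampledEdges I.weight (fun v => #(keptSets n k input v)) x (rate I k input x) ≤
      edgeBudget n :=
  Nat.findGreatest_spec (P := fun q =>
    sampledEdges I.weight (fun v => #(keptSets n k input v)) x q ≤ edgeBudget n) (Nat.zero_le _) (by simp [sampledEdges])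

/-- Machine `0` knows only the elements sampled at rate `B`, which include those sampled at any
rate `q ≤ B`. -/
theorem chosenRate_offers (I : WeightedCover n m) (k : ℕ) (input : List Data) (x : Fin m → ℕ) :
    chosenRate n (offers I k input x) = rate I k input x := by
  refine findGreatest_congr fun q hq => ?_
  rw [offeredEdges, offers, sum_map_lettersOf, sampledEdges]
  have : ∀ v, (if x v < edgeBudget n * I.weight v then
      (if x v < q * I.weight v then #(keptSets n k input v) else 0) else 0) =
      if x v < q * I.weight v then #(keptSets n k input v) else 0 := by
    intro v
    have := Nat.mul_le_mul_right (I.weight v) hq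
    split_ifs <;> first | rfl | omega
  simp [List.getI, this]

theorem listScore_replies (h : I.IsInput input) (k : ℕ) (x : Fin m → ℕ) {l : List ℕ}
    {T : Finset (Fin n)} (hl : l.toFinset = T.map Fin.valEmbedding) :
    listScore (replies I k input x) l =
      familyScore (2 ^ Nat.size I.totalWeight) I.weight (keptSets n k input) (rate I k input x) x
        T := by
  rw [listScore, replies, sum_map_lettersOf, familyScore, sampleScore]
  refine sum_congr rfl fun v _ => ?_
  have hiff : (∃ y ∈ keptList k n input v, y ∈ l) ↔ ¬ Disjoint (keptSets n k input v) T := by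
    have hmem : ∀ y, y ∈ l ↔ ∃ S ∈ T, (S : ℕ) = y := fun y => by
      rw [← List.mem_toFinset, hl]; simp
    rw [not_disjoint_iff]
    constructor
    · rintro ⟨y, hy, hyl⟩
      obtain ⟨S, hS, rfl⟩ := mem_keptList_lt h hy
      obtain ⟨S', hS', heq⟩ := (hmem _).mp hyl
      exact ⟨S, hS, by rwa [← Fin.ext heq]⟩
    · rintro ⟨S, hS, hST⟩
      exact ⟨S, by simpa [keptSets] using hS, (hmem _).mpr ⟨S, hST, rfl⟩⟩
  simp only [List.tail_cons, List.headI_cons, hiff]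
  by_cases h1 : x v < rate I k input x * I.weight v <;>
    by_cases h2 : Disjoint (keptSets n k input v) T <;> simp [h1, h2]

theorem bestChoice_replies (h : I.IsInput input) {k : ℕ} (hk : k ≤ n) (x : Fin m → ℕ) :
    ∃ T : Finset (Fin n),
      (bestChoice n k (replies I k input x)).toFinset = T.map Fin.valEmbedding ∧
      IsBestFamily (2 ^ Nat.size I.totalWeight) I.weight (keptSets n k input) k
        (rate I k input x) x T := by
  obtain ⟨T, hT, hlT⟩ := exists_family_of_mem_choices (bestChoice_mem hk (replies I k input x))
  refine ⟨T, hlT, hT, fun T' hT' => ?_⟩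
  obtain ⟨l, hl, hlT'⟩ := exists_mem_choices hT'
  rw [← listScore_replies h k x hlT, ← listScore_replies h k x hlT']
  exact (listScore_le_foldl_better _ _ _).2 l hl

end KCover

namespace KCover

open MapReduce

variable {n m : ℕ}

section Run

variable {I : WeightedCover n m} {input : List Data} {k U : ℕ}
  (ω : Fin 4 → RoundCoins (m + 1) (algorithm.coins (I.publicParams k U)))

theorem digest_recordsAt_zero (n k : ℕ) (input : List Data) :
    digest n k (recordsAt input 0) = [0] := by
  rw [recordsAt_zero]; simp [digest, weightOf, edgesOf]

theorem configAfter_succ (r : Fin 4) :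
    configAfter algorithm (I.publicParams k U) input ω (r + 1) =
      nextConfig algorithm (I.publicParams k U) r (ω r)
        (configAfter algorithm (I.publicParams k U) input ω r) := by
  rw [configAfter, dif_pos r.2]

theorem nextConfig_apply {p l : ℕ} (A : Algorithm) (pub : List ℕ) (r : ℕ)
    (c : RoundCoins (p + 1) l) (s : Config (p + 1)) (j : Fin (p + 1)) :
    nextConfig A pub r c s j = ((localResult A pub r c s j).1,
      (((localResult A pub r c s 0).2.filter fun x => x.1 = (j : ℕ)).map Prod.snd) ++
        (List.finRange p).flatMap fun v =>
          ((localResult A pub r c s v.succ).2.filter fun x => x.1 = (j : ℕ)).map Prod.snd) := by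
  rw [nextConfig, List.finRange_succ, List.flatMap_cons, List.flatMap_map]

/-- The situation of machine `i` after the first round. -/
def afterOffers (I : WeightedCover n m) (k : ℕ) (input : List Data) (x : Fin m → ℕ)
    (i : Fin (m + 1)) : Data × List Data :=
  (digest n k (recordsAt input i), if i = 0 then offers I k input x else [])

/-- The messages that machine `i` receives in the second round. -/
def requestsTo (I : WeightedCover n m) (k : ℕ) (input : List Data) (x : Fin m → ℕ) :
    Fin (m + 1) → List Data :=
  Fin.cases [] fun v =>
    if x v < rate I k input x * I.weight v then [[rate I k input x]] else []

theorem localResult_first_zero :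
    localResult algorithm (I.publicParams k U) 0 (ω 0)
      (configAfter algorithm (I.publicParams k U) input ω 0) 0 = ([0], []) := by
  have : localResult algorithm (I.publicParams k U) 0 (ω 0)
      (configAfter algorithm (I.publicParams k U) input ω 0) 0 =
      offerStep (I.publicParams k U) 0 (List.ofFn (ω 0 0)) (recordsAt input 0) := rfl
  rw [this, recordsAt_zero]
  simp [offerStep, digest, weightOf, edgesOf]

theorem localResult_first_succ (h : I.IsInput input) (v : Fin m) :
    localResult algorithm (I.publicParams k U) 0 (ω 0)
      (configAfter algorithm (I.publicParams k U) input ω 0) v.succ =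
      (digest n k (recordsAt input (v + 1)),
        if drawn ω v < edgeBudget n * I.weight v then
          [(0, [(v : ℕ) + 1, I.weight v, #(keptSets n k input v), drawn ω v])] else []) := by
  have : localResult algorithm (I.publicParams k U) 0 (ω 0)
      (configAfter algorithm (I.publicParams k U) input ω 0) v.succ =
      offerStep (I.publicParams k U) (v + 1) (List.ofFn (ω 0 v.succ))
        (recordsAt input (v + 1)) := rfl
  rw [this, offerStep, weightOf_recordsAt h]
  have hd : digest ((I.publicParams k U).getI 0) ((I.publicParams k U).getI 2)
      (recordsAt input (v + 1)) = digest n k (recordsAt input (v + 1)) := rfl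
  rw [hd, digest_recordsAt h, List.tail_cons, length_keptList h]
  rfl

theorem configAfter_one (h : I.IsInput input) :
    configAfter algorithm (I.publicParams k U) input ω 1 = afterOffers I k input (drawn ω) := by
  refine (configAfter_succ ω 0).trans ?_
  funext j
  rw [nextConfig_apply]
  refine Prod.ext ?_ ?_
  · refine Fin.cases ?_ (fun v => ?_) j
    · exact (congrArg Prod.fst (localResult_first_zero ω)).trans
        (digest_recordsAt_zero n k input).symm
    · exact (congrArg Prod.fst (localResult_first_succ ω h v)).trans rfl
  · have h0 := localResult_first_zero (input := input) ω
    have h1 := localResult_first_succ ω h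
    simp only [Fin.val_zero, Fin.isValue] at h0 h1 ⊢
    simp only [h0, h1, List.filter_nil, List.map_nil, List.nil_append, afterOffers, offers,
      lettersOf]
    refine Fin.cases ?_ (fun w => ?_) j
    · rw [if_pos rfl]
      congr 1
      funext v
      split_ifs <;> simp
    · rw [if_neg (Fin.succ_ne_zero w)]
      rw [List.flatMap_eq_nil_iff]
      intro v _
      split_ifs <;> simp

theorem localResult_second (i : Fin (m + 1)) (h : I.IsInput input) :
    localResult algorithm (I.publicParams k U) 1 (ω 1)
      (configAfter algorithm (I.publicParams k U) input ω 1) i =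
      (digest n k (recordsAt input i),
        if i = 0 then (lettersOf (fun v => drawn ω v < rate I k input (drawn ω) * I.weight v)
          fun v => [(v : ℕ) + 1]).map fun d => (d.headI, [rate I k input (drawn ω)]) else []) := by
  have : localResult algorithm (I.publicParams k U) 1 (ω 1)
      (configAfter algorithm (I.publicParams k U) input ω 1) i =
      requestStep (I.publicParams k U) (configAfter algorithm (I.publicParams k U) input ω 1 i).1
        (configAfter algorithm (I.publicParams k U) input ω 1 i).2 := rfl
  rw [this, configAfter_one ω h, requestStep]
  have hn : (I.publicParams k U).getI 0 = n := rfl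
  refine Prod.ext rfl ?_
  simp only [afterOffers, hn]
  by_cases hi : i = 0
  · simp only [hi, if_true, chosenRate_offers]
    rw [offers, lettersOf, lettersOf]
    have hle := rate_le I k input (drawn ω)
    induction List.finRange m with
    | nil => rfl
    | cons v l ih =>
      rw [List.flatMap_cons, List.flatMap_cons, List.filter_append, List.map_append,
        List.map_append, ih]
      congr 1
      have := Nat.mul_le_mul_right (I.weight v) hle
      by_cases h1 : drawn ω v < rate I k input (drawn ω) * I.weight v
      · simp [h1, lt_of_lt_of_le h1 this, List.getI]
      · by_cases h2 : drawn ω v < edgeBudget n * I.weight v <;> simp [h1, h2, List.getI]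
  · simp [hi]

theorem configAfter_two (h : I.IsInput input) (j : Fin (m + 1)) :
    configAfter algorithm (I.publicParams k U) input ω 2 j =
      (digest n k (recordsAt input j), requestsTo I k input (drawn ω) j) := by
  refine (congrFun (configAfter_succ ω 1) j).trans ?_
  rw [nextConfig_apply]
  have h1 := fun i => localResult_second ω i h
  have hv : ((1 : Fin 4) : ℕ) = 1 := rfl
  simp only [hv, h1]
  refine Prod.ext rfl ?_
  simp only [if_true, Fin.succ_ne_zero, if_false, List.filter_nil, List.map_nil]
  rw [List.flatMap_eq_nil_iff.mpr fun _ _ => rfl, List.append_nil]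
  -- among the requests sent by machine `0`, the one for element `v` is the only one with address
  -- `v + 1`
  have key : ∀ (L : List (Fin m)), L.Nodup →
      ((((L.flatMap fun v => if drawn ω v < rate I k input (drawn ω) * I.weight v then
        [[(v : ℕ) + 1]] else []).map fun d : Data => (d.headI, [rate I k input (drawn ω)])).filter
          fun x : Letter => x.1 = (j : ℕ)).map Prod.snd) =
        if ∃ v ∈ L, (v : ℕ) + 1 = j then requestsTo I k input (drawn ω) j else [] := by
    intro L
    induction L with
    | nil => simp
    | cons v L ih =>
      intro hnd
      rw [List.nodup_cons] at hnd
      rw [List.flatMap_cons, List.map_append, List.filter_append, List.map_append, ih hnd.2]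
      by_cases hj : (v : ℕ) + 1 = j
      · have hjs : j = v.succ := Fin.ext hj.symm
        have hno : ¬ ∃ v' ∈ L, (v' : ℕ) + 1 = j := by
          rintro ⟨v', hv', he⟩
          have : v' = v := Fin.ext (by omega)
          exact hnd.1 (this ▸ hv')
        have hex : ∃ v' ∈ v :: L, (v' : ℕ) + 1 = j := ⟨v, List.mem_cons_self, hj⟩
        rw [if_neg hno, if_pos hex, List.append_nil]
        subst hjs
        rw [requestsTo, Fin.cases_succ]
        split_ifs <;> simp
      · have h0 : (((if drawn ω v < rate I k input (drawn ω) * I.weight v then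
            [[(v : ℕ) + 1]] else []).map fun d : Data =>
              (d.headI, [rate I k input (drawn ω)])).filter
            fun x : Letter => x.1 = (j : ℕ)) = [] := by
          split_ifs <;> simp [hj]
        rw [h0]
        simp [hj]
  rw [lettersOf, key _ (List.nodup_finRange m)]
  refine Fin.cases ?_ (fun v => ?_) j
  · simp [requestsTo]
  · rw [if_pos ⟨v, List.mem_finRange v, rfl⟩]

theorem localResult_third (i : Fin (m + 1)) (h : I.IsInput input) :
    localResult algorithm (I.publicParams k U) 2 (ω 2)
      (configAfter algorithm (I.publicParams k U) input ω 2) i =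
      ([], Fin.cases [] (fun v => if drawn ω v < rate I k input (drawn ω) * I.weight v then
        [(0, max (2 ^ Nat.size I.totalWeight) (rate I k input (drawn ω) * I.weight v) ::
          keptList k n input v)] else []) i) := by
  have : localResult algorithm (I.publicParams k U) 2 (ω 2)
      (configAfter algorithm (I.publicParams k U) input ω 2) i =
      replyStep (I.publicParams k U) (configAfter algorithm (I.publicParams k U) input ω 2 i).1
        (configAfter algorithm (I.publicParams k U) input ω 2 i).2 := rfl
  rw [this, configAfter_two ω h, replyStep]
  have hW : (I.publicParams k U).getI 4 = I.totalWeight := rfl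
  rw [hW]
  refine Prod.ext rfl ?_
  refine Fin.cases ?_ (fun v => ?_) i
  · rfl
  · simp only [requestsTo, Fin.cases_succ, Fin.val_succ, digest_recordsAt h]
    split_ifs <;> simp

theorem configAfter_three (h : I.IsInput input) (j : Fin (m + 1)) :
    configAfter algorithm (I.publicParams k U) input ω 3 j =
      ([], if j = 0 then replies I k input (drawn ω) else []) := by
  refine (congrFun (configAfter_succ ω 2) j).trans ?_
  rw [nextConfig_apply]
  have h1 := fun i => localResult_third ω i h
  have hv : ((2 : Fin 4) : ℕ) = 2 := rfl
  simp only [hv, h1]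
  refine Prod.ext rfl ?_
  simp only [Fin.cases_zero, Fin.cases_succ, List.filter_nil, List.map_nil, List.nil_append,
    replies, lettersOf]
  refine Fin.cases ?_ (fun w => ?_) j
  · rw [if_pos rfl]
    congr 1
    funext v
    split_ifs <;> simp
  · rw [if_neg (Fin.succ_ne_zero w), List.flatMap_eq_nil_iff]
    intro v _
    split_ifs <;> simp

theorem localResult_fourth (i : Fin (m + 1)) (h : I.IsInput input) :
    localResult algorithm (I.publicParams k U) 3 (ω 3)
      (configAfter algorithm (I.publicParams k U) input ω 3) i =
      (bestChoice n k (if i = 0 then replies I k input (drawn ω) else []), []) := by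
  have : localResult algorithm (I.publicParams k U) 3 (ω 3)
      (configAfter algorithm (I.publicParams k U) input ω 3) i =
      (bestChoice n k (configAfter algorithm (I.publicParams k U) input ω 3 i).2, []) := rfl
  rw [this, configAfter_three ω h]

theorem output_eq (h : I.IsInput input) :
    output algorithm (I.publicParams k U) input ω =
      bestChoice n k (replies I k input (drawn ω)) := by
  have h1 : output algorithm (I.publicParams k U) input ω =
      (localResult algorithm (I.publicParams k U) 3 (ω 3)
        (configAfter algorithm (I.publicParams k U) input ω 3) 0).1 :=
    congrArg Prod.fst (congrFun (configAfter_succ ω 3) 0)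
  rw [h1, localResult_fourth ω 0 h, if_pos rfl]

end Run

end KCover

namespace KCover

open MapReduce

variable {n m : ℕ}

/-! ### The space used by the algorithm -/

theorem bits_le {d : Data} {X N : ℕ} (h : ∀ x ∈ d, Nat.size x + 1 ≤ X) (hl : d.length ≤ N) :
    bits d ≤ 1 + N * X := by
  unfold bits
  have h1 : (d.map fun a => Nat.size a + 1).sum ≤ (d.map fun a => Nat.size a + 1).length • X :=
    List.sum_le_card_nsmul _ _ fun y hy => by
      obtain ⟨x, hx, rfl⟩ := List.mem_map.mp hy
      exact h x hx
  rw [List.length_map, smul_eq_mul] at h1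
  have := Nat.mul_le_mul_right X hl
  omega

theorem sum_map_bits_le {l : List Data} {Y N : ℕ} (h : ∀ d ∈ l, bits d ≤ Y) (hl : l.length ≤ N) :
    (l.map bits).sum ≤ N * Y := by
  have h1 : (l.map bits).sum ≤ (l.map bits).length • Y :=
    List.sum_le_card_nsmul _ _ fun y hy => by
      obtain ⟨x, hx, rfl⟩ := List.mem_map.mp hy
      exact h x hx
  rw [List.length_map, smul_eq_mul] at h1
  exact h1.trans (Nat.mul_le_mul_right Y hl)

/-- The logarithmic factor in the space bound. -/
def logFactor (n m U : ℕ) : ℕ := Nat.size (n + m + U)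

theorem logFactor_pos {n : ℕ} (hn : 1 ≤ n) (m U : ℕ) : 1 ≤ logFactor n m U :=
  Nat.size_pos.mpr (by omega)

theorem size_le_logFactor {n m U a : ℕ} (h : a ≤ n + m + U) : Nat.size a ≤ logFactor n m U :=
  Nat.size_le_size h

theorem lt_two_pow_logFactor {n m U a : ℕ} (h : a ≤ n + m + U) : a < 2 ^ logFactor n m U :=
  Nat.size_le.mp (size_le_logFactor h)

theorem edgeBudget_le (n m U : ℕ) : edgeBudget n ≤ 2000000 * n * logFactor n m U :=
  Nat.mul_le_mul_left _ (size_le_logFactor (by omega))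

theorem edgeBudget_lt_two_pow (n m U : ℕ) : edgeBudget n < 2 ^ (21 + 2 * logFactor n m U) := by
  have h1 : n < 2 ^ logFactor n m U := lt_two_pow_logFactor (by omega)
  have h2 : Nat.size n < 2 ^ logFactor n m U :=
    Nat.lt_two_pow_self.trans_le
      (Nat.pow_le_pow_right (by norm_num) (size_le_logFactor (by omega)))
  calc edgeBudget n = 2000000 * (n * Nat.size n) := by rw [edgeBudget]; ring
    _ ≤ 2000000 * (2 ^ logFactor n m U * 2 ^ logFactor n m U) := by gcongr
    _ < 2 ^ 21 * (2 ^ logFactor n m U * 2 ^ logFactor n m U) := by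
        gcongr
        norm_num
    _ = _ := by rw [← pow_add, ← pow_add]; congr 1; ring

theorem size_totalWeight_le {U : ℕ} (I : WeightedCover n m) (hU : ∀ v, I.weight v ≤ U) :
    Nat.size I.totalWeight ≤ 2 * logFactor n m U := by
  rw [Nat.size_le]
  have h1 : I.totalWeight ≤ m * U := by
    refine (sum_le_card_nsmul univ I.weight U fun v _ => hU v).trans ?_
    simp
  have h2 : m < 2 ^ logFactor n m U := lt_two_pow_logFactor (by omega)
  have h3 : U < 2 ^ logFactor n m U := lt_two_pow_logFactor (by omega)
  calc I.totalWeight ≤ m * U := h1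
    _ < 2 ^ logFactor n m U * 2 ^ logFactor n m U := Nat.mul_lt_mul'' h2 h3
    _ = _ := by rw [← pow_add]; congr 1; ring

/-- The price of one entry of a list of moderate numbers. -/
theorem size_add_one_le {L a : ℕ} (hL : 1 ≤ L) (h : a < 2 ^ (21 + 3 * L)) :
    Nat.size a + 1 ≤ 25 * L := by
  have := Nat.size_le.mpr h
  omega

theorem size_add_one_le_of_le {n m U a : ℕ} (hn : 1 ≤ n) (h : a ≤ n + m + U) :
    Nat.size a + 1 ≤ 25 * logFactor n m U := by
  have := size_le_logFactor h
  have := logFactor_pos hn m U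
  omega

section Space

variable {I : WeightedCover n m} {input : List Data} {k U : ℕ}

theorem length_recordsAt_le (h : I.IsInput input) (v : Fin m) :
    (recordsAt input (v + 1)).length ≤ n + 1 := by
  rw [← List.toFinset_card_of_nodup (nodup_recordsAt h _)]
  have hsub : (recordsAt input (v + 1)).toFinset ⊆
      insert [1, (v : ℕ), I.weight v] (univ.image fun S : Fin n => [0, (v : ℕ), (S : ℕ)]) := by
    intro d hd
    rcases (mem_recordsAt h).mp (List.mem_toFinset.mp hd) with ⟨S, -, rfl⟩ | rfl
    · exact mem_insert_of_mem (mem_image_of_mem _ (mem_univ S))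
    · exact mem_insert_self _ _
  refine (card_le_card hsub).trans ((card_insert_le _ _).trans ?_)
  have := card_image_le (s := univ) (f := fun S : Fin n => [0, (v : ℕ), (S : ℕ)])
  simp only [card_univ, Fintype.card_fin] at this
  omega

theorem sum_bits_recordsAt_le (h : I.IsInput input) (hn : 1 ≤ n) (hU : ∀ v, I.weight v ≤ U)
    (i : Fin (m + 1)) :
    ((recordsAt input i).map bits).sum ≤ 152 * n * logFactor n m U := by
  have hL := logFactor_pos hn m U
  refine Fin.cases ?_ (fun v => ?_) i
  · rw [Fin.val_zero, recordsAt_zero]; simp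
  · rw [Fin.val_succ]
    have h1 : ∀ d ∈ recordsAt input (v + 1), bits d ≤ 1 + 3 * (25 * logFactor n m U) := by
      intro d hd
      rcases (mem_recordsAt h).mp hd with ⟨S, -, rfl⟩ | rfl
      · refine bits_le (fun x hx => size_add_one_le_of_le hn ?_) le_rfl
        simp only [List.mem_cons, List.not_mem_nil, or_false] at hx
        have := v.2
        have := S.2
        omega
      · refine bits_le (fun x hx => size_add_one_le_of_le hn ?_) le_rfl
        simp only [List.mem_cons, List.not_mem_nil, or_false] at hx
        have := v.2
        have := hU v
        omega
    refine (sum_map_bits_le h1 (length_recordsAt_le h v)).trans ?_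
    nlinarith

theorem length_keptList_le (h : I.IsInput input) (k : ℕ) (v : Fin m) :
    (keptList k n input v).length ≤ n := by
  rw [length_keptList h]
  simpa using card_le_univ (keptSets n k input v)

theorem bits_digest_le (h : I.IsInput input) (hn : 1 ≤ n) (hU : ∀ v, I.weight v ≤ U) (k : ℕ)
    (i : Fin (m + 1)) :
    bits (digest n k (recordsAt input i)) ≤ 51 * n * logFactor n m U := by
  have hL := logFactor_pos hn m U
  have key : bits (digest n k (recordsAt input i)) ≤ 1 + (n + 1) * (25 * logFactor n m U) := by
    refine Fin.cases ?_ (fun v => ?_) i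
    · rw [Fin.val_zero, digest_recordsAt_zero]
      exact bits_le (fun x hx => size_add_one_le_of_le hn (by simp at hx; omega)) (by simp)
    · rw [Fin.val_succ, digest_recordsAt h]
      refine bits_le (fun x hx => size_add_one_le_of_le hn ?_)
        (Nat.succ_le_succ (length_keptList_le h k v))
      rcases List.mem_cons.mp hx with rfl | hx
      · have := hU v; omega
      · obtain ⟨S, -, rfl⟩ := mem_keptList_lt h hx
        have := S.2; omega
  refine key.trans ?_
  nlinarith

theorem coinNumber_ofFn_lt {l : ℕ} (c : Fin l → Bool) : coinNumber (List.ofFn c) < 2 ^ l := by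
  induction l with
  | zero => simp [coinNumber]
  | succ l ih =>
    have h1 : coinNumber (List.ofFn c) =
        (c 0).toNat + 2 * coinNumber (List.ofFn fun i => c i.succ) := by
      rw [List.ofFn_succ]; rfl
    have h2 := ih fun i => c i.succ
    have h3 := Bool.toNat_le (c 0)
    rw [h1, pow_succ]
    omega

variable (ω : Fin 4 → RoundCoins (m + 1) (algorithm.coins (I.publicParams k U)))

theorem bits_offer_le (hn : 1 ≤ n) (hU : ∀ v, I.weight v ≤ U) (v : Fin m) :
    bits [(v : ℕ) + 1, I.weight v, #(keptSets n k input v), drawn ω v] ≤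
      101 * logFactor n m U := by
  have hL := logFactor_pos hn m U
  have h1 : bits [(v : ℕ) + 1, I.weight v, #(keptSets n k input v), drawn ω v] ≤
      1 + 4 * (25 * logFactor n m U) := by
    refine bits_le (fun x hx => ?_) le_rfl
    simp only [List.mem_cons, List.not_mem_nil, or_false] at hx
    rcases hx with rfl | rfl | rfl | rfl
    · have := v.2
      exact size_add_one_le_of_le hn (by omega)
    · have := hU v
      exact size_add_one_le_of_le hn (by omega)
    · have : #(keptSets n k input v) ≤ n := by simpa using card_le_univ (keptSets n k input v)
      exact size_add_one_le_of_le hn (by omega)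
    · refine size_add_one_le hL ((coinNumber_ofFn_lt (ω 0 v.succ)).trans_le ?_)
      refine Nat.pow_le_pow_right (by norm_num) ?_
      have : algorithm.coins (I.publicParams k U) = Nat.size I.totalWeight := rfl
      have := size_totalWeight_le I hU
      omega
  omega

theorem bits_request_le (hn : 1 ≤ n) (x : Fin m → ℕ) :
    bits [rate I k input x] ≤ 26 * logFactor n m U := by
  have hL := logFactor_pos hn m U
  have h1 : bits [rate I k input x] ≤ 1 + 1 * (25 * logFactor n m U) := by
    refine bits_le (fun y hy => ?_) le_rfl
    rw [List.mem_singleton] at hy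
    subst hy
    refine size_add_one_le hL (((rate_le I k input x).trans_lt
      (edgeBudget_lt_two_pow n m U)).trans_le ?_)
    exact Nat.pow_le_pow_right (by norm_num) (by omega)
  omega

theorem bits_reply_le (h : I.IsInput input) (hn : 1 ≤ n) (hU : ∀ v, I.weight v ≤ U)
    (x : Fin m → ℕ) (v : Fin m) :
    bits (max (2 ^ Nat.size I.totalWeight) (rate I k input x * I.weight v) ::
      keptList k n input v) ≤ 1 + (#(keptSets n k input v) + 1) * (25 * logFactor n m U) := by
  have hL := logFactor_pos hn m U
  refine bits_le (fun y hy => ?_) (by rw [List.length_cons, length_keptList h])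
  rcases List.mem_cons.mp hy with rfl | hy
  · refine size_add_one_le hL (max_lt ?_ ?_)
    · refine Nat.pow_lt_pow_right (by norm_num) ?_
      have := size_totalWeight_le I hU
      omega
    · have h1 := (rate_le I k input x).trans_lt (edgeBudget_lt_two_pow n m U)
      have h2 : I.weight v < 2 ^ logFactor n m U :=
        lt_two_pow_logFactor (by have := hU v; omega)
      calc rate I k input x * I.weight v
          < 2 ^ (21 + 2 * logFactor n m U) * 2 ^ logFactor n m U := Nat.mul_lt_mul'' h1 h2
        _ = _ := by rw [← pow_add]; congr 1; ring
  · obtain ⟨S, -, rfl⟩ := mem_keptList_lt h hy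
    have := S.2
    exact size_add_one_le_of_le hn (by omega)

theorem sum_if_le_card_mul {p : Fin m → Prop} [DecidablePred p] {f : Fin m → ℕ} {Y N : ℕ}
    (hf : ∀ v, f v ≤ Y) (hp : #{v | p v} ≤ N) : (∑ v, if p v then f v else 0) ≤ N * Y := by
  rw [← sum_filter]
  refine (sum_le_card_nsmul _ _ Y fun v _ => hf v).trans ?_
  rw [smul_eq_mul]
  exact Nat.mul_le_mul_right Y hp

theorem card_sampled_le {x : Fin m → ℕ}
    (hx : #{v | x v < edgeBudget n * I.weight v} ≤ 4 * edgeBudget n) :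
    #{v | x v < rate I k input x * I.weight v} ≤ 4 * edgeBudget n := by
  refine (card_le_card fun v hv => ?_).trans hx
  simp only [mem_filter, mem_univ, true_and] at hv ⊢
  exact hv.trans_le (Nat.mul_le_mul_right _ (rate_le I k input x))

theorem space_first_le (h : I.IsInput input) (hn : 1 ≤ n) (hU : ∀ v, I.weight v ≤ U)
    (i : Fin (m + 1)) :
    space algorithm (I.publicParams k U) input ω 0 i ≤ 305 * n * logFactor n m U := by
  have hL := logFactor_pos hn m U
  have hnL : logFactor n m U ≤ n * logFactor n m U := Nat.le_mul_of_pos_left _ hn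
  have hr := sum_bits_recordsAt_le h hn hU i
  have hd := bits_digest_le h hn hU k i
  have hs : space algorithm (I.publicParams k U) input ω 0 i =
      bits [] + ((recordsAt input i).map bits).sum +
        bits (digest n k (recordsAt input i)) +
        ((localResult algorithm (I.publicParams k U) 0 (ω 0)
          (configAfter algorithm (I.publicParams k U) input ω 0) i).2.map
            fun x => Nat.size x.1 + bits x.2).sum := rfl
  have hb : bits [] = 1 := rfl
  have hl : ((localResult algorithm (I.publicParams k U) 0 (ω 0)
      (configAfter algorithm (I.publicParams k U) input ω 0) i).2.map
        fun x => Nat.size x.1 + bits x.2).sum ≤ 101 * logFactor n m U := by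
    refine Fin.cases ?_ (fun v => ?_) i
    · rw [localResult_first_zero]; simp
    · rw [localResult_first_succ ω h]
      have := bits_offer_le (input := input) ω hn hU v
      split_ifs
      · simpa using this
      · simp
  rw [hs, hb]
  nlinarith

theorem space_second_le (h : I.IsInput input) (hn : 1 ≤ n) (hU : ∀ v, I.weight v ≤ U)
    (hω : #{v | drawn ω v < edgeBudget n * I.weight v} ≤ 4 * edgeBudget n) (i : Fin (m + 1)) :
    space algorithm (I.publicParams k U) input ω 1 i ≤
      102 * n * logFactor n m U + 608 * edgeBudget n * logFactor n m U := by
  have hL := logFactor_pos hn m U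
  have hd := bits_digest_le h hn hU k i
  have hs : space algorithm (I.publicParams k U) input ω 1 i =
      bits (configAfter algorithm (I.publicParams k U) input ω 1 i).1 +
        ((configAfter algorithm (I.publicParams k U) input ω 1 i).2.map bits).sum +
        bits (localResult algorithm (I.publicParams k U) 1 (ω 1)
          (configAfter algorithm (I.publicParams k U) input ω 1) i).1 +
        ((localResult algorithm (I.publicParams k U) 1 (ω 1)
          (configAfter algorithm (I.publicParams k U) input ω 1) i).2.map
            fun x => Nat.size x.1 + bits x.2).sum := rfl
  rw [hs, localResult_second ω i h, configAfter_one ω h]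
  have h1 : ((afterOffers I k input (drawn ω) i).2.map bits).sum ≤
      4 * edgeBudget n * (101 * logFactor n m U) := by
    unfold afterOffers
    split_ifs
    · rw [offers, sum_map_lettersOf]
      exact sum_if_le_card_mul (fun v => bits_offer_le ω hn hU v) hω
    · simp
  have h2 : ((if i = 0 then (lettersOf
      (fun v => drawn ω v < rate I k input (drawn ω) * I.weight v)
        fun v => [(v : ℕ) + 1]).map fun d => (d.headI, [rate I k input (drawn ω)]) else []).map
          fun x : Letter => Nat.size x.1 + bits x.2).sum ≤
      4 * edgeBudget n * (51 * logFactor n m U) := by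
    split_ifs
    · rw [List.map_map, sum_map_lettersOf]
      refine sum_if_le_card_mul (fun v => ?_) (card_sampled_le hω)
      have h3 := bits_request_le (I := I) (k := k) (U := U) (input := input) hn (drawn ω)
      have h4 : Nat.size ((v : ℕ) + 1) + 1 ≤ 25 * logFactor n m U :=
        size_add_one_le_of_le hn (by have := v.2; omega)
      simp only [Function.comp_apply, List.headI_cons]
      omega
    · simp
  have h3 : bits (afterOffers I k input (drawn ω) i).1 ≤ 51 * n * logFactor n m U := hd
  simp only
  nlinarith

theorem space_third_le (h : I.IsInput input) (hn : 1 ≤ n) (hU : ∀ v, I.weight v ≤ U)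
    (i : Fin (m + 1)) :
    space algorithm (I.publicParams k U) input ω 2 i ≤ 129 * n * logFactor n m U := by
  have hL := logFactor_pos hn m U
  have hnL : logFactor n m U ≤ n * logFactor n m U := Nat.le_mul_of_pos_left _ hn
  have hd := bits_digest_le h hn hU k i
  have hs : space algorithm (I.publicParams k U) input ω 2 i =
      bits (configAfter algorithm (I.publicParams k U) input ω 2 i).1 +
        ((configAfter algorithm (I.publicParams k U) input ω 2 i).2.map bits).sum +
        bits (localResult algorithm (I.publicParams k U) 2 (ω 2)
          (configAfter algorithm (I.publicParams k U) input ω 2) i).1 +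
        ((localResult algorithm (I.publicParams k U) 2 (ω 2)
          (configAfter algorithm (I.publicParams k U) input ω 2) i).2.map
            fun x => Nat.size x.1 + bits x.2).sum := rfl
  rw [hs, localResult_third ω i h, configAfter_two ω h]
  have hb : bits [] = 1 := rfl
  have h1 : ((requestsTo I k input (drawn ω) i).map bits).sum ≤ 26 * logFactor n m U := by
    refine Fin.cases ?_ (fun v => ?_) i
    · simp [requestsTo]
    · rw [requestsTo, Fin.cases_succ]
      have := bits_request_le (I := I) (k := k) (U := U) (input := input) hn (drawn ω)
      split_ifs
      · simpa using this
      · simp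
  have h2 : (((Fin.cases [] (fun v => if drawn ω v < rate I k input (drawn ω) * I.weight v then
        [(0, max (2 ^ Nat.size I.totalWeight) (rate I k input (drawn ω) * I.weight v) ::
          keptList k n input v)] else []) i : List Letter)).map
            fun x : Letter => Nat.size x.1 + bits x.2).sum ≤ 51 * n * logFactor n m U := by
    refine Fin.cases ?_ (fun v => ?_) i
    · simp
    · rw [Fin.cases_succ]
      have h3 := bits_reply_le (k := k) h hn hU (drawn ω) v
      have h4 : #(keptSets n k input v) ≤ n := by simpa using card_le_univ (keptSets n k input v)
      have h5 : 1 + (#(keptSets n k input v) + 1) * (25 * logFactor n m U) ≤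
          51 * n * logFactor n m U := by nlinarith
      split_ifs
      · simpa using h3.trans h5
      · simp
  simp only [hb]
  nlinarith

theorem space_fourth_le (h : I.IsInput input) (hn : 1 ≤ n) (hk : k ≤ n)
    (hU : ∀ v, I.weight v ≤ U) (hK : ∀ v : Fin m, 0 < #(keptSets n k input v)) (i : Fin (m + 1)) :
    space algorithm (I.publicParams k U) input ω 3 i ≤
      27 * n * logFactor n m U + 51 * edgeBudget n * logFactor n m U := by
  have hL := logFactor_pos hn m U
  have hnL : logFactor n m U ≤ n * logFactor n m U := Nat.le_mul_of_pos_left _ hn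
  have hs : space algorithm (I.publicParams k U) input ω 3 i =
      bits (configAfter algorithm (I.publicParams k U) input ω 3 i).1 +
        ((configAfter algorithm (I.publicParams k U) input ω 3 i).2.map bits).sum +
        bits (localResult algorithm (I.publicParams k U) 3 (ω 3)
          (configAfter algorithm (I.publicParams k U) input ω 3) i).1 +
        ((localResult algorithm (I.publicParams k U) 3 (ω 3)
          (configAfter algorithm (I.publicParams k U) input ω 3) i).2.map
            fun x => Nat.size x.1 + bits x.2).sum := rfl
  rw [hs, localResult_fourth ω i h, configAfter_three ω h]
  have hb : bits [] = 1 := rfl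
  have h1 : ((if i = 0 then replies I k input (drawn ω) else []).map bits).sum ≤
      edgeBudget n * (51 * logFactor n m U) := by
    split_ifs
    · rw [replies, sum_map_lettersOf]
      refine le_trans ?_ (Nat.mul_le_mul_right _ (sampledEdges_rate_le I k input (drawn ω)))
      rw [sampledEdges, sum_mul]
      refine sum_le_sum fun v _ => ?_
      have h3 := bits_reply_le (k := k) h hn hU (drawn ω) v
      have h4 := hK v
      split_ifs
      · refine h3.trans ?_
        nlinarith
      · simp
    · simp
  obtain ⟨h3, h4⟩ := mem_choices.mp
    (bestChoice_mem hk (if i = 0 then replies I k input (drawn ω) else []))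
  have h2 : bits (bestChoice n k (if i = 0 then replies I k input (drawn ω) else [])) ≤
      1 + n * (25 * logFactor n m U) := by
    refine bits_le (fun x hx => size_add_one_le_of_le hn ?_) (h4.trans_le hk)
    have := List.mem_range.mp (h3.subset hx)
    omega
  simp only [hb, List.map_nil, List.sum_nil]
  nlinarith

/-- Unless too many elements are sampled at the largest rate, the space is `O(n log² (n + m + U))`
in all rounds. -/
theorem space_le (h : I.IsInput input) (hn : 1 ≤ n) (hk : k ≤ n)
    (hU : ∀ v, I.weight v ≤ U) (hK : ∀ v : Fin m, 0 < #(keptSets n k input v))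
    (hω : #{v | drawn ω v < edgeBudget n * I.weight v} ≤ 4 * edgeBudget n)
    (r : Fin 4) (i : Fin (m + 1)) :
    space algorithm (I.publicParams k U) input ω r i ≤
      2000000000 * n * logFactor n m U ^ 2 := by
  have hL := logFactor_pos hn m U
  have hB := Nat.mul_le_mul_right (logFactor n m U) (edgeBudget_le n m U)
  have hnL : n * logFactor n m U ≤ n * logFactor n m U ^ 2 := by
    rw [pow_two]
    exact Nat.mul_le_mul_left _ (Nat.le_mul_of_pos_left _ hL)
  have hB' : edgeBudget n * logFactor n m U ≤ 2000000 * (n * logFactor n m U ^ 2) := by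
    calc _ ≤ _ := hB
      _ = _ := by ring
  have h0 := space_first_le ω h hn hU i
  have h1 := space_second_le ω h hn hU hω i
  have h2 := space_third_le ω h hn hU i
  have h3 := space_fourth_le ω h hn hk hU hK i
  have key : ∀ s, s ≤ 305 * (n * logFactor n m U) + 608 * (edgeBudget n * logFactor n m U) →
      s ≤ 2000000000 * n * logFactor n m U ^ 2 := by
    intro s hs
    calc s ≤ 2000000000 * (n * logFactor n m U ^ 2) := by omega
      _ = _ := by ring
  have z1 := Nat.zero_le (n * logFactor n m U)
  have z2 := Nat.zero_le (edgeBudget n * logFactor n m U)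
  match r with
  | 0 => exact key _ (by linarith)
  | 1 => exact key _ (by linarith)
  | 2 => exact key _ (by linarith)
  | 3 => exact key _ (by linarith)

theorem logFactor_le_log (hn : 1 ≤ n) (m U : ℕ) :
    (logFactor n m U : ℝ) ≤ 2 * (1 + Real.log (n + m + U)) := by
  have hL := logFactor_pos hn m U
  obtain ⟨L, hLe⟩ : ∃ L, logFactor n m U = L + 1 := ⟨_, (Nat.sub_add_cancel hL).symm⟩
  have h1 : 2 ^ L ≤ n + m + U := Nat.lt_size.mp (by rw [← logFactor, hLe]; omega)
  have h2 : (2 : ℝ) ^ L ≤ n + m + U := by exact_mod_cast h1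
  have h3 := Real.log_le_log (by positivity) h2
  rw [Real.log_pow] at h3
  have h4 := Real.log_two_gt_d9
  rw [hLe]
  push_cast
  have h5 : (0 : ℝ) ≤ L := by positivity
  nlinarith

end Space

end KCover

namespace KCover

open MapReduce

variable {n m : ℕ}

/-! ### The coins, and the conclusion -/

theorem coinNumber_ofFn_injective {l : ℕ} :
    Function.Injective fun c : Fin l → Bool => coinNumber (List.ofFn c) := by
  induction l with
  | zero => exact fun c c' _ => Subsingleton.elim c c'
  | succ l ih =>
    intro c c' h
    have key : ∀ c : Fin (l + 1) → Bool, coinNumber (List.ofFn c) =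
        (c 0).toNat + 2 * coinNumber (List.ofFn fun i => c i.succ) := fun c => by
      rw [List.ofFn_succ]; rfl
    simp only [key] at h
    have h1 := Bool.toNat_le (c 0)
    have h2 := Bool.toNat_le (c' 0)
    have h3 : (c 0).toNat = (c' 0).toNat := by omega
    have h4 := ih (a₁ := fun i => c i.succ) (a₂ := fun i => c' i.succ) (by
      simp only
      omega)
    funext i
    refine Fin.cases ?_ (fun i => ?_) i
    · exact (by decide : ∀ a b : Bool, a.toNat = b.toNat → a = b) _ _ h3
    · exact congrFun h4 i

theorem sum_coinNumber (l : ℕ) (g : ℕ → ℝ) :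
    ∑ c : Fin l → Bool, g (coinNumber (List.ofFn c)) = ∑ x ∈ range (2 ^ l), g x := by
  have himage : (univ : Finset (Fin l → Bool)).image (fun c => coinNumber (List.ofFn c)) =
      range (2 ^ l) := by
    refine eq_of_subset_of_card_le (fun x hx => ?_) ?_
    · obtain ⟨c, -, rfl⟩ := mem_image.mp hx
      exact mem_range.mpr (coinNumber_ofFn_lt c)
    · rw [card_image_of_injective _ coinNumber_ofFn_injective]
      simp
  rw [← himage, sum_image fun c _ c' _ h => coinNumber_ofFn_injective h]

/-- The numbers drawn by the elements are independent and uniform. -/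
theorem uniformIndep_drawn (m l : ℕ) :
    UniformIndep (2 ^ l) fun (ω : Fin 4 → RoundCoins (m + 1) l) (v : Fin m) => drawn ω v := by
  intro g
  have he : Function.Injective fun v : Fin m => ((0 : Fin 4), v.succ) := fun v v' h =>
    Fin.succ_injective _ (Prod.ext_iff.mp h).2
  have h := sum_prod_comp_injective he fun v (c : Fin l → Bool) => g v (coinNumber (List.ofFn c))
  rw [← (Equiv.curry (Fin 4) (Fin (m + 1)) (Fin l → Bool)).sum_comp,
    ← Fintype.card_congr (Equiv.curry (Fin 4) (Fin (m + 1)) (Fin l → Bool))]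
  refine Eq.trans h ?_
  congr 1
  refine prod_congr rfl fun v _ => ?_
  rw [sum_coinNumber l (g v)]
  simp

/-- A union bound for two bad events of probability `1 / n` each. -/
theorem uniform_ge_of_bad_events {Ω : Type*} [Fintype Ω] [Nonempty Ω] {n : ℕ} (hn : 0 < n)
    {G : Set Ω} {E F : Finset Ω} (hG : ∀ ω, ω ∉ E → ω ∉ F → ω ∈ G)
    (hE : (n : ℝ) * #E ≤ Fintype.card Ω) (hF : (n : ℝ) * #F ≤ Fintype.card Ω) :
    ENNReal.ofReal (1 - 2 / (n : ℝ)) ≤ (PMF.uniformOfFintype Ω).toOuterMeasure G := by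
  classical
  have hn' : (0 : ℝ) < n := by exact_mod_cast hn
  have hc : (0 : ℝ) < Fintype.card Ω := by exact_mod_cast Fintype.card_pos
  have hcover : Fintype.card Ω ≤ Fintype.card G + #E + #F := by
    have h1 : (univ : Finset Ω) ⊆ G.toFinset ∪ E ∪ F := by
      intro ω _
      simp only [mem_union, Set.mem_toFinset]
      by_cases hE' : ω ∈ E
      · exact Or.inl (Or.inr hE')
      · by_cases hF' : ω ∈ F
        · exact Or.inr hF'
        · exact Or.inl (Or.inl (hG ω hE' hF'))
    have h2 := card_le_card h1
    have h3 := card_union_le (G.toFinset ∪ E) F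
    have h4 := card_union_le G.toFinset E
    rw [Set.toFinset_card] at h4
    rw [card_univ] at h2
    omega
  rw [PMF.toOuterMeasure_uniformOfFintype_apply, ← ENNReal.ofReal_natCast,
    ← ENNReal.ofReal_natCast, ← ENNReal.ofReal_div_of_pos hc]
  apply ENNReal.ofReal_le_ofReal
  rw [le_div_iff₀ hc]
  have h5 : (Fintype.card Ω : ℝ) ≤ Fintype.card G + #E + #F := by exact_mod_cast hcover
  have h6 : (#E : ℝ) ≤ Fintype.card Ω / n := by rw [le_div_iff₀ hn']; linarith
  have h7 : (#F : ℝ) ≤ Fintype.card Ω / n := by rw [le_div_iff₀ hn']; linarith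
  have h8 : (1 - 2 / (n : ℝ)) * Fintype.card Ω =
      Fintype.card Ω - Fintype.card Ω / n - Fintype.card Ω / n := by ring
  rw [h8]
  linarith

variable {I : WeightedCover n m} {input : List Data} {k U : ℕ}

theorem mul_degreeCap_le (hk : k ≤ n) : k * degreeCap n k ≤ 21 * n := by
  rw [degreeCap, mul_add, mul_one]
  have := Nat.mul_div_le (20 * n) k
  omega

theorem lt_mul_degreeCap (hk : 0 < k) : 20 * n < k * degreeCap n k :=
  Nat.lt_mul_div_succ _ hk

theorem card_keptSets_pos (h : I.IsInput input) (hcov : ∀ v : Fin m, ∃ S : Fin n, v ∈ I.sets S)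
    (v : Fin m) : 0 < #(keptSets n k input v) := by
  rw [card_keptSets h]
  obtain ⟨S, hS⟩ := hcov v
  exact lt_min (Nat.succ_pos _) (card_pos.mpr ⟨S, by simp [memberSets, hS]⟩)

/-- A family within `4 / 5` of the optimum for the capped lists is within `16 / 25` of the optimum
for the instance. -/
theorem isApproxSolution_of_hitWeight (h : I.IsInput input) (hn : 1 ≤ n) (hk : 0 < k)
    {T : Finset (Fin n)} (hT : #T = k)
    (hopt : ∀ O : Finset (Fin n), #O = k →
      4 * hitWeight I.weight (keptSets n k input) O ≤
        5 * hitWeight I.weight (keptSets n k input) T) {α : ℝ} (hα : α ≤ 16 / 25) :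
    I.IsApproxSolution k α T := by
  refine ⟨hT, fun O hO => ?_⟩
  obtain ⟨T₁, hT₁, h1⟩ := exists_hitWeight_ge_of_capped hn I.weight (lt_mul_degreeCap hk)
    (keptSets_subset h k) (card_keptSets h k) hO
  have h2 := hopt T₁ hT₁
  have h3 := hitWeight_mono_left I.weight (keptSets_subset h k) T
  rw [coverage_eq_hitWeight, coverage_eq_hitWeight]
  have h4 : 16 * hitWeight I.weight (memberSets I) O ≤
      25 * hitWeight I.weight (memberSets I) T := by omega
  have h5 : (16 : ℝ) * hitWeight I.weight (memberSets I) O ≤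
      25 * hitWeight I.weight (memberSets I) T := by exact_mod_cast h4
  have h6 : α * hitWeight I.weight (memberSets I) O ≤
      16 / 25 * hitWeight I.weight (memberSets I) O := by gcongr
  linarith

theorem isApproxSolution_of_trivial {T : Finset (Fin n)} (hT : #T = k) {α : ℝ}
    (h0 : ∀ O : Finset (Fin n), #O = k → I.coverage O = 0) : I.IsApproxSolution k α T := by
  refine ⟨hT, fun O hO => ?_⟩
  rw [h0 O hO]
  simp

theorem coverage_le_totalWeight (I : WeightedCover n m) (T : Finset (Fin n)) :
    I.coverage T ≤ I.totalWeight :=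
  sum_le_sum_of_subset (subset_univ _)

theorem one_sub_inv_exp_le {ε : ℝ} (hε : 0 < ε) : 1 - 1 / Real.exp 1 - ε ≤ 16 / 25 := by
  have h1 := Real.exp_one_lt_d9
  have h2 : (9 / 25 : ℝ) ≤ 1 / Real.exp 1 := by
    rw [le_div_iff₀ (Real.exp_pos 1)]
    linarith
  linarith

end KCover

theorem mainTheorem7 :
    ∃ c : ℕ, ∀ ε : ℝ, 0 < ε → ε ≤ 1 → ∃ (C : ℝ) (A : MapReduce.Algorithm),
      ∀ (n m k U : ℕ) (I : WeightedCover n m) (input : List MapReduce.Data),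
        1 ≤ n → k ≤ n →
        (∀ v : Fin m, I.weight v ≤ U) →
        (∀ v : Fin m, ∃ S : Fin n, v ∈ I.sets S) →
        I.IsInput input →
        ENNReal.ofReal (1 - 2 / (n : ℝ)) ≤
          (PMF.uniformOfFintype
            (Fin 4 → MapReduce.RoundCoins (m + 1) (A.coins (I.publicParams k U)))).toOuterMeasure
            {ω |
              (∃ T : Finset (Fin n),
                I.IsApproxSolution k (1 - 1 / Real.exp 1 - ε) T ∧
                (MapReduce.output A (I.publicParams k U) input ω).toFinset =
                  T.map Fin.valEmbedding) ∧
              ∀ (r : Fin 4) (i : Fin (m + 1)),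
                (MapReduce.space A (I.publicParams k U) input ω r i : ℝ) ≤
                  C * n * (1 + Real.log (n + m + U)) ^ c} := by
  classical
  refine ⟨2, fun ε hε _ => ⟨8000000000, KCover.algorithm, ?_⟩⟩
  intro n m k U I input hn hk hU hcov hin
  -- for `n ≤ 2` the claimed probability is not positive
  rcases Nat.lt_or_ge n 3 with hn3 | hn3
  · have h1 : ENNReal.ofReal (1 - 2 / (n : ℝ)) = 0 := by
      rw [ENNReal.ofReal_eq_zero, sub_nonpos, le_div_iff₀ (by exact_mod_cast hn), one_mul]
      exact_mod_cast (by omega : n ≤ 2)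
    rw [h1]
    exact zero_le
  have hK : ∀ v, 0 < #(KCover.keptSets n k input v) := KCover.card_keptSets_pos hin hcov
  have hu := KCover.uniformIndep_drawn m (KCover.algorithm.coins (I.publicParams k U))
  have hN : ∑ v, I.weight v < 2 ^ KCover.algorithm.coins (I.publicParams k U) :=
    Nat.lt_size_self I.totalWeight
  have hmany := hu.card_many_samples_le hn3 I.weight hN
  have hspace : ∀ ω : Fin 4 →
      MapReduce.RoundCoins (m + 1) (KCover.algorithm.coins (I.publicParams k U)),
      #{v | KCover.drawn ω v < edgeBudget n * I.weight v} < 4 * edgeBudget n →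
      ∀ (r : Fin 4) (i : Fin (m + 1)),
        (MapReduce.space KCover.algorithm (I.publicParams k U) input ω r i : ℝ) ≤
          8000000000 * n * (1 + Real.log (n + m + U)) ^ 2 := by
    intro ω hω r i
    have h1 : (MapReduce.space KCover.algorithm (I.publicParams k U) input ω r i : ℝ) ≤
        2000000000 * n * (KCover.logFactor n m U : ℝ) ^ 2 := by
      exact_mod_cast KCover.space_le ω hin hn hk hU hK hω.le r i
    have h2 := KCover.logFactor_le_log hn m U
    calc _ ≤ _ := h1
      _ ≤ 2000000000 * n * (2 * (1 + Real.log (n + m + U))) ^ 2 := by gcongr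
      _ = _ := by ring
  -- without weight or without choice all families are optimal, and only the space matters
  by_cases htriv : k = 0 ∨ I.totalWeight = 0
  · have h0 : ∀ O : Finset (Fin n), #O = k → I.coverage O = 0 := by
      intro O hO
      rcases htriv with h | h
      · rw [h, card_eq_zero] at hO
        simp [hO, WeightedCover.coverage]
      · have := KCover.coverage_le_totalWeight I O
        omega
    refine KCover.uniform_ge_of_bad_events hn (fun ω hω _ => ⟨?_, hspace ω ?_⟩) hmany
      (F := ∅) (by rw [card_empty, Nat.cast_zero, mul_zero]; positivity)
    · obtain ⟨T, hTo, hT⟩ := KCover.bestChoice_replies hin hk (KCover.drawn ω)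
      exact ⟨T, KCover.isApproxSolution_of_trivial hT.1 h0, by rw [KCover.output_eq ω hin, hTo]⟩
    · simpa using hω
  · push Not at htriv
    have hk0 : 0 < k := Nat.pos_of_ne_zero htriv.1
    have hNW : 2 ^ KCover.algorithm.coins (I.publicParams k U) ≤ 2 * ∑ v, I.weight v := by
      have h1 : 0 < Nat.size I.totalWeight := Nat.size_pos.mpr (Nat.pos_of_ne_zero htriv.2)
      have h2 : 2 ^ (Nat.size I.totalWeight - 1) ≤ I.totalWeight := Nat.lt_size.mp (by omega)
      calc 2 ^ KCover.algorithm.coins (I.publicParams k U)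
          = 2 ^ (Nat.size I.totalWeight - 1 + 1) := by rw [Nat.sub_add_cancel h1]; rfl
        _ = 2 * 2 ^ (Nat.size I.totalWeight - 1) := by rw [pow_succ, mul_comm]
        _ ≤ _ := Nat.mul_le_mul_left 2 h2
    have hqual := hu.card_bad_quality_le hn3 hk0 hk I.weight (KCover.keptSets n k input) hK
      (fun v => by
        rw [KCover.card_keptSets hin]
        exact (Nat.mul_le_mul_left k (min_le_left _ _)).trans (KCover.mul_degreeCap_le hk))
      hN hNW
    refine KCover.uniform_ge_of_bad_events hn (fun ω hω hω' => ⟨?_, hspace ω ?_⟩) hmany hqual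
    · obtain ⟨T, hTo, hT⟩ := KCover.bestChoice_replies hin hk (KCover.drawn ω)
      refine ⟨T, ?_, by rw [KCover.output_eq ω hin, hTo]⟩
      refine KCover.isApproxSolution_of_hitWeight hin hn hk0 hT.1 ?_
        (KCover.one_sub_inv_exp_le hε)
      simp only [mem_filter, mem_univ, true_and, not_not] at hω'
      exact hω' T hT
    · simpa using hω
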